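/- Let $(x_i)_{i\in\mathbb N}$ be pairwise distinct positive numbers and let $(d_i)_{i\in\mathbb N}$ be nonnegative numbers. For $r\ge 0$ put $$N(r)=\sum_{x_j\le r} d_j^2,\qquad M(r)=\sum_{x_j\ge r}\frac{d_j^2}{x_j^2}\qquad(\text{values in }[0,\infty]),$$ and for $L\in\mathbb N$ $$\tilde{\mathcal B}(L)=\sup_{K\ge L} N\Big(\max_{L\le i\le K}x_i\Big)\,M\Big(\inf_{i\ge K}x_i\Big)+\sup_{k\ge L}N(x_k)M(x_k),$$ with the convention $0\cdot\infty=0$. Call $(x_i)$ monotonically rearrangeable if $(x_{\sigma(i)})_i$ is strictly increasing or strictly decreasing for some bijection $\sigma:\mathbb N\to\mathbb N$. Consider the operators - $A:L^2(0,1)\to\ell^2$, $Af=\big(d_n\int_0^1 f(t)\,t^{\lambda_n}\,dt\big)_n$ with $\lambda_n=x_n-\tfrac12$, and its adjoint $A^*:\ell^2\to L^2(0,1)$, $A^*f=\sum_i d_if_i\,t^{\lambda_i}$; - $L:L^2(0,\infty)\to\ell^2$, $Lf=\big(d_n\int_0^\infty e^{-x_nt}f(t)\,dt\big)_n$, and its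 adjoint $L^*:\ell^2\to L^2(0,\infty)$, $L^*f=\sum_i d_if_i\,e^{-x_it}$; - $C:\ell^2\to\ell^2$, $Cf=\big(\frac{d_n}{x_n}\sum_{x_k\le x_n}d_kf_k\big)_n$, and its adjoint $C^*:\ell^2\to\ell^2$, $C^*f=\big(d_n\sum_{x_k\ge x_n}\frac{d_kf_k}{x_k}\big)_n$. Here an operator is well-defined if for every element $f$ of the space all integrals and series in its definition converge (for $A^*$ and $L^*$: at almost every $t$) and the result lies in the target space. Let $T$ be any of the ten operators $A$, $A^*$, $A^*A$, $L$, $L^*$, $L^*L$, $C$, $C^*$, $CC^*$, $C^*C$. Then: (2) $T$ is well-defined and bounded if $\tilde{\mathcal B}(1)<\infty$. (3) $T$ is compact if it is (well-defined and) bounded and $\lim_{L\to\infty}\tilde{\mathcal B}(L)=0$. If moreover $(x_i)$ is monotonically rearrangeable, then: (2a) $T$ is well-defined and bounded if and only if $\sup_{k}N(x_k)M(x_k)<\infty$. (3a) $T$ is compact if and only if it is bounded and $\lim_{L\to\infty}\sup_{k\ge L}N(x_k)M(x_k)=0$. -/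

import Mathlib

open MeasureTheory Filter Topology
open scoped ENNReal

noncomputable section

/-! Sequences are indexed by `ℕ = {0, 1, 2, …}`; the index `0` here plays the role of the
first index. -/

/-- The sequence space `ℓ²` over `𝕜` (real or complex scalars). -/
abbrev EllTwo (𝕜 : Type*) [RCLike 𝕜] : Type _ := lp (fun _ : ℕ => 𝕜) 2

/-- `N(r) = ∑_{x_j ≤ r} d_j²`, with values in `[0, ∞]`. -/
def sumN (x d : ℕ → ℝ) (r : ℝ) : ℝ≥0∞ :=
  ∑' j : {j : ℕ // x j ≤ r}, ENNReal.ofReal (d j ^ 2)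

/-- `M(r) = ∑_{x_j ≥ r} d_j² / x_j²`, with values in `[0, ∞]`. -/
def sumM (x d : ℕ → ℝ) (r : ℝ) : ℝ≥0∞ :=
  ∑' j : {j : ℕ // r ≤ x j}, ENNReal.ofReal (d j ^ 2 / x j ^ 2)

/-- `sup_{K ≥ L} N(max_{L ≤ i ≤ K} x_i) M(inf_{i ≥ K} x_i) + sup_{k ≥ L} N(x_k) M(x_k)`. -/
def boundB (x d : ℕ → ℝ) (L : ℕ) : ℝ≥0∞ :=
  (⨆ K ≥ L, sumN x d (sSup (x '' Set.Icc L K)) * sumM x d (sInf (x '' Set.Ici K))) +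
    ⨆ k ≥ L, sumN x d (x k) * sumM x d (x k)

/-- The sequence can be rearranged to be strictly increasing or strictly decreasing. -/
def MonotonicallyRearrangeable (x : ℕ → ℝ) : Prop :=
  ∃ σ : Equiv.Perm ℕ, StrictMono (x ∘ σ) ∨ StrictAnti (x ∘ σ)

section Operators

/-- The operator `f ↦ (d_n ∫ f φ_n dμ)_n` from `L²(μ)` to `ℓ²`. Its domain consists of all `f`
for which every integral exists and the resulting sequence is in `ℓ²`. -/
def samplingOp (𝕜 : Type*) [RCLike 𝕜] (μ : Measure ℝ) (φ : ℕ → ℝ → ℝ) (d : ℕ → ℝ) :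
    Lp 𝕜 2 μ →ₗ.[𝕜] EllTwo 𝕜 where
  domain :=
    { carrier := {f | (∀ n, Integrable (fun t => f t * (φ n t : 𝕜)) μ) ∧
        Memℓp (fun n => (d n : 𝕜) * ∫ t, f t * (φ n t : 𝕜) ∂μ) 2}
      zero_mem' := by
        have h (n : ℕ) : (fun t => (0 : Lp 𝕜 2 μ) t * (φ n t : 𝕜)) =ᵐ[μ] fun _ => 0 := by
          filter_upwards [Lp.coeFn_zero 𝕜 2 μ] with t ht
          rw [ht, Pi.zero_apply, zero_mul]
        refine ⟨fun n => (integrable_zero ℝ 𝕜 μ).congr (h n).symm, ?_⟩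
        simp only [fun n => integral_congr_ae (h n), integral_zero, mul_zero]
        exact zero_memℓp
      add_mem' := by
        rintro f g ⟨hf, hf'⟩ ⟨hg, hg'⟩
        have h (n : ℕ) : (fun t => (f + g) t * (φ n t : 𝕜)) =ᵐ[μ]
            fun t => f t * (φ n t : 𝕜) + g t * (φ n t : 𝕜) := by
          filter_upwards [Lp.coeFn_add f g] with t ht
          rw [ht, Pi.add_apply, add_mul]
        refine ⟨fun n => ((hf n).add (hg n)).congr (h n).symm, ?_⟩
        simp only [fun n => integral_congr_ae (h n), fun n => integral_add (hf n) (hg n), mul_add]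
        exact hf'.add hg'
      smul_mem' := by
        rintro c f ⟨hf, hf'⟩
        have h (n : ℕ) : (fun t => (c • f) t * (φ n t : 𝕜)) =ᵐ[μ]
            fun t => c * (f t * (φ n t : 𝕜)) := by
          filter_upwards [Lp.coeFn_smul c f] with t ht
          simp [ht, mul_assoc]
        refine ⟨fun n => ((hf n).const_mul c).congr (h n).symm, ?_⟩
        simp only [fun n => integral_congr_ae (h n), integral_const_mul, mul_left_comm _ c]
        exact hf'.const_smul c }
  toFun :=
    { toFun := fun f => ⟨fun n => (d n : 𝕜) * ∫ t, f.1 t * (φ n t : 𝕜) ∂μ, f.2.2⟩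
      map_add' := by
        rintro ⟨f, hf⟩ ⟨g, hg⟩
        ext n
        have h : (fun t => (f + g) t * (φ n t : 𝕜)) =ᵐ[μ]
            fun t => f t * (φ n t : 𝕜) + g t * (φ n t : 𝕜) := by
          filter_upwards [Lp.coeFn_add f g] with t ht
          rw [ht, Pi.add_apply, add_mul]
        change (d n : 𝕜) * ∫ t, (f + g) t * (φ n t : 𝕜) ∂μ =
          (d n : 𝕜) * ∫ t, f t * (φ n t : 𝕜) ∂μ + (d n : 𝕜) * ∫ t, g t * (φ n t : 𝕜) ∂μ
        rw [integral_congr_ae h, integral_add (hf.1 n) (hg.1 n), mul_add]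
      map_smul' := by
        rintro c ⟨f, hf⟩
        ext n
        have h : (fun t => (c • f) t * (φ n t : 𝕜)) =ᵐ[μ]
            fun t => c * (f t * (φ n t : 𝕜)) := by
          filter_upwards [Lp.coeFn_smul c f] with t ht
          simp [ht, mul_assoc]
        change (d n : 𝕜) * ∫ t, (c • f) t * (φ n t : 𝕜) ∂μ =
          c * ((d n : 𝕜) * ∫ t, f t * (φ n t : 𝕜) ∂μ)
        rw [integral_congr_ae h, integral_const_mul, mul_left_comm] }

/-- The operator `(f_i)_i ↦ ∑_i d_i f_i φ_i`, the sum being a function of `t`, from `ℓ²` to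
`L²(μ)`. Its domain consists of all `f` for which the series converges at almost every point
and its sum is square integrable. -/
def synthesisOp (𝕜 : Type*) [RCLike 𝕜] (μ : Measure ℝ) (φ : ℕ → ℝ → ℝ) (d : ℕ → ℝ) :
    EllTwo 𝕜 →ₗ.[𝕜] Lp 𝕜 2 μ where
  domain :=
    { carrier := {f | (∀ᵐ t ∂μ, Summable fun i => (d i : 𝕜) * f i * (φ i t : 𝕜)) ∧
        MemLp (fun t => ∑' i, (d i : 𝕜) * f i * (φ i t : 𝕜)) 2 μ}
      zero_mem' := by
        simp [summable_zero]
      add_mem' := by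
        rintro f g ⟨hf, hf'⟩ ⟨hg, hg'⟩
        constructor
        · filter_upwards [hf, hg] with t h₁ h₂
          simpa [mul_add, add_mul] using h₁.add h₂
        · refine (memLp_congr_ae ?_).1 (hf'.add hg')
          filter_upwards [hf, hg] with t h₁ h₂
          simp only [Pi.add_apply, lp.coeFn_add, mul_add, add_mul]
          exact (h₁.tsum_add h₂).symm
      smul_mem' := by
        rintro c f ⟨hf, hf'⟩
        constructor
        · filter_upwards [hf] with t h₁
          simpa [mul_assoc, mul_left_comm _ c] using h₁.mul_left c
        · refine (memLp_congr_ae ?_).1 (hf'.const_smul c)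
          filter_upwards with t
          simp [mul_assoc, mul_left_comm _ c, tsum_mul_left] }
  toFun :=
    { toFun := fun f => f.2.2.toLp
      map_add' := by
        rintro ⟨f, hf⟩ ⟨g, hg⟩
        rw [← MemLp.toLp_add, MemLp.toLp_eq_toLp_iff]
        filter_upwards [hf.1, hg.1] with t h₁ h₂
        simp only [Pi.add_apply, lp.coeFn_add, mul_add, add_mul, Submodule.coe_add]
        exact h₁.tsum_add h₂
      map_smul' := by
        rintro c ⟨f, hf⟩
        rw [RingHom.id_apply, ← MemLp.toLp_const_smul, MemLp.toLp_eq_toLp_iff]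
        filter_upwards with t
        simp [mul_assoc, mul_left_comm _ c, tsum_mul_left] }

/-- The operator `f ↦ (a_n ∑_{k : R n k} b_k f_k)_n` in `ℓ²`. Its domain consists of all `f` for
which every sum converges and the resulting sequence is in `ℓ²`. -/
def summationOp (𝕜 : Type*) [RCLike 𝕜] (R : ℕ → ℕ → Prop) (a b : ℕ → ℝ) :
    EllTwo 𝕜 →ₗ.[𝕜] EllTwo 𝕜 where
  domain :=
    { carrier := {f | (∀ n, Summable fun k : {k : ℕ // R n k} => (b k : 𝕜) * f k) ∧
        Memℓp (fun n => (a n : 𝕜) * ∑' k : {k : ℕ // R n k}, (b k : 𝕜) * f k) 2}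
      zero_mem' := by
        refine ⟨fun n => by simp [summable_zero], ?_⟩
        simp only [lp.coeFn_zero, Pi.zero_apply, mul_zero, tsum_zero]
        exact zero_memℓp
      add_mem' := by
        rintro f g ⟨hf, hf'⟩ ⟨hg, hg'⟩
        refine ⟨fun n => by simpa [mul_add] using (hf n).add (hg n), ?_⟩
        simp only [lp.coeFn_add, Pi.add_apply, mul_add, fun n => (hf n).tsum_add (hg n)]
        exact hf'.add hg'
      smul_mem' := by
        rintro c f ⟨hf, hf'⟩
        refine ⟨fun n => by simpa [mul_left_comm _ c] using (hf n).mul_left c, ?_⟩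
        simp only [lp.coeFn_smul, Pi.smul_apply, smul_eq_mul, mul_left_comm _ c, tsum_mul_left]
        exact hf'.const_smul c }
  toFun :=
    { toFun := fun f => ⟨fun n => (a n : 𝕜) * ∑' k : {k : ℕ // R n k}, (b k : 𝕜) * f.1 k, f.2.2⟩
      map_add' := by
        rintro ⟨f, hf⟩ ⟨g, hg⟩
        ext n
        change (a n : 𝕜) * ∑' k : {k : ℕ // R n k}, (b k : 𝕜) * (f k + g k) =
          (a n : 𝕜) * (∑' k : {k : ℕ // R n k}, (b k : 𝕜) * f k) +
            (a n : 𝕜) * ∑' k : {k : ℕ // R n k}, (b k : 𝕜) * g k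
        simp only [mul_add, (hf.1 n).tsum_add (hg.1 n)]
      map_smul' := by
        rintro c ⟨f, hf⟩
        ext n
        change (a n : 𝕜) * ∑' k : {k : ℕ // R n k}, (b k : 𝕜) * (c * f k) =
          c * ((a n : 𝕜) * ∑' k : {k : ℕ // R n k}, (b k : 𝕜) * f k)
        simp only [mul_left_comm _ c, tsum_mul_left] }

/-- Generalized Hausdorff moment operator
`L²(0,1) → ℓ²`, `f ↦ (d_n ∫₀¹ f(t) t^{lam_n} dt)_n`. -/
def hausdorffOp (𝕜 : Type*) [RCLike 𝕜] (lam d : ℕ → ℝ) :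
    Lp 𝕜 2 (volume.restrict (Set.Ioo (0 : ℝ) 1)) →ₗ.[𝕜] EllTwo 𝕜 :=
  samplingOp 𝕜 _ (fun n t => t ^ lam n) d

/-- Its adjoint `ℓ² → L²(0,1)`, `(f_i)_i ↦ ∑_i d_i f_i t^{lam_i}`. -/
def hausdorffAdj (𝕜 : Type*) [RCLike 𝕜] (lam d : ℕ → ℝ) :
    EllTwo 𝕜 →ₗ.[𝕜] Lp 𝕜 2 (volume.restrict (Set.Ioo (0 : ℝ) 1)) :=
  synthesisOp 𝕜 _ (fun n t => t ^ lam n) d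

/-- Sampled Laplace transform `L²(0,∞) → ℓ²`, `f ↦ (d_n ∫₀^∞ e^{-x_n t} f(t) dt)_n`. -/
def laplaceOp (𝕜 : Type*) [RCLike 𝕜] (x d : ℕ → ℝ) :
    Lp 𝕜 2 (volume.restrict (Set.Ioi (0 : ℝ))) →ₗ.[𝕜] EllTwo 𝕜 :=
  samplingOp 𝕜 _ (fun n t => Real.exp (-(x n * t))) d

/-- Its adjoint `ℓ² → L²(0,∞)`, `(f_i)_i ↦ ∑_i d_i f_i e^{-x_i t}`. -/
def laplaceAdj (𝕜 : Type*) [RCLike 𝕜] (x d : ℕ → ℝ) :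
    EllTwo 𝕜 →ₗ.[𝕜] Lp 𝕜 2 (volume.restrict (Set.Ioi (0 : ℝ))) :=
  synthesisOp 𝕜 _ (fun n t => Real.exp (-(x n * t))) d

/-- Generalized Cesàro–Hardy operator `ℓ² → ℓ²`, `f ↦ ((d_n / x_n) ∑_{x_k ≤ x_n} d_k f_k)_n`. -/
def cesaroOp (𝕜 : Type*) [RCLike 𝕜] (x d : ℕ → ℝ) : EllTwo 𝕜 →ₗ.[𝕜] EllTwo 𝕜 :=
  summationOp 𝕜 (fun n k => x k ≤ x n) (fun n => d n / x n) d

/-- Its adjoint `ℓ² → ℓ²`, `f ↦ (d_n ∑_{x_k ≥ x_n} d_k f_k / x_k)_n`. -/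
def cesaroAdj (𝕜 : Type*) [RCLike 𝕜] (x d : ℕ → ℝ) : EllTwo 𝕜 →ₗ.[𝕜] EllTwo 𝕜 :=
  summationOp 𝕜 (fun n k => x n ≤ x k) d (fun k => d k / x k)

variable {𝕜 : Type*} [RCLike 𝕜] {E F G : Type*} [NormedAddCommGroup E] [NormedSpace 𝕜 E]
  [NormedAddCommGroup F] [NormedSpace 𝕜 F] [NormedAddCommGroup G] [NormedSpace 𝕜 G]

/-- The composition `T ∘ S`, with domain `{f ∈ dom S | S f ∈ dom T}`. -/
def compOp (T : F →ₗ.[𝕜] G) (S : E →ₗ.[𝕜] F) : E →ₗ.[𝕜] G :=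
  T.comp (S.domRestrict ((T.domain.comap S.toFun).map S.domain.subtype)) (by
    rintro ⟨f, hf, hfS⟩
    obtain ⟨g, hg, rfl⟩ := hf
    exact hg)

/-- `T` is well-defined on the whole space and bounded. -/
def IsBoundedOp (T : E →ₗ.[𝕜] F) : Prop :=
  T.domain = ⊤ ∧ ∃ c : ℝ, ∀ f : T.domain, ‖T f‖ ≤ c * ‖f‖

/-- `T` is well-defined on the whole space and compact. -/
def IsCompactOp (T : E →ₗ.[𝕜] F) : Prop :=
  T.domain = ⊤ ∧ IsCompactOperator T

/-- The boundedness and compactness criteria in terms of `x`, `d` for the operator `T`: two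
sufficient conditions for arbitrary `x`, and two characterizations for monotonically
rearrangeable `x`. -/
def SatisfiesCriteria (x d : ℕ → ℝ) (T : E →ₗ.[𝕜] F) : Prop :=
  (boundB x d 0 < ∞ → IsBoundedOp T) ∧
  (IsBoundedOp T → Tendsto (boundB x d) atTop (𝓝 0) → IsCompactOp T) ∧
  (MonotonicallyRearrangeable x →
    (IsBoundedOp T ↔ (⨆ k, sumN x d (x k) * sumM x d (x k)) < ∞) ∧
    (IsCompactOp T ↔ IsBoundedOp T ∧
      Tendsto (fun L => ⨆ k ≥ L, sumN x d (x k) * sumM x d (x k)) atTop (𝓝 0)))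

end Operators

end

/-! One quantity governs all ten operators: the products N_F(x_k) M_F(x_k) formed over finite index
sets F (`muckenhoupt`). Boundedness of T is equivalent to their uniform boundedness, and T is
compact if moreover they tend to 0 as k grows. The sufficient conditions follow because sup N(x_k)
M(x_k) is a summand of `boundB`. Rearrangeability enters only when compactness must force the
products to vanish.

Upper bounds: Muckenhoupt's proof of the weighted Hardy inequality works on finite sets
(`hardy_inequality_finset`) and passes to the limit. The functions t^(x_n - 1/2) and e^(-x_n t) both
have Gram matrix 1/(x_n + x_k) (`HasCauchyGram`), and 1/(x_n + x_k) ≤ 1/max(x_n, x_k) bounds this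
matrix by the Hardy matrix plus its transpose (`sum_sum_div_add_le`).

Lower bounds: for x_j ≤ x_n the Cauchy entries are at least half the Hardy entries, so testing on d
restricted to {x_j ≤ x_k} recovers the products (`muckenhoupt_le_of_entries`).

Compactness: if the products vanish, discarding finitely many coordinates leaves an operator of
small norm. Conversely, the rows of a compact operator into ℓ² are uniformly small off a finite set,
and a locally finite order places all rows seen by the k-th product off that set when k is large.
Adjoints correspond to x ↦ -x, and T*T is compact exactly when T is. -/

noncomputable section

/-! ### Weighted Hardy and Cauchy-kernel inequalities for finite sums. -/

section FiniteHardy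

variable {ι : Type*}

/-- `∑ w_k / √W_k ≤ 2 √W`, where the `W_k` are the partial sums of `w` in the order given by `x`
and `W` is the full sum. -/
theorem Finset.sum_div_sqrt_partialSum_le (F : Finset ι) (x w : ι → ℝ) (hw : ∀ i, 0 ≤ w i) :
    ∑ k ∈ F, w k / √(∑ j ∈ F with x j ≤ x k, w j) ≤ 2 * √(∑ j ∈ F, w j) := by
  classical
  induction F using Finset.induction_on_max_value x with
  | empty => simp
  | insert a s ha hmax ih =>
    have hall : ({j ∈ insert a s | x j ≤ x a} : Finset ι) = insert a s := by
      refine Finset.filter_true_of_mem fun j hj => ?_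
      rcases Finset.mem_insert.1 hj with rfl | hj
      exacts [le_rfl, hmax j hj]
    rw [Finset.sum_insert ha, hall]
    -- The new index joins the partial sum at k only in case of a tie, and this only enlarges the
    -- denominator.
    have h1 : ∑ k ∈ s, w k / √(∑ j ∈ insert a s with x j ≤ x k, w j) ≤
        ∑ k ∈ s, w k / √(∑ j ∈ s with x j ≤ x k, w j) := by
      refine Finset.sum_le_sum fun k hk => ?_
      rcases (hw k).eq_or_lt with h0 | h0
      · simp [← h0]
      have hpos : 0 < ∑ j ∈ s with x j ≤ x k, w j :=
        h0.trans_le (Finset.single_le_sum (f := w) (fun i _ => hw i)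
          (Finset.mem_filter.2 ⟨hk, le_rfl⟩))
      refine div_le_div_of_nonneg_left h0.le (Real.sqrt_pos.2 hpos) (Real.sqrt_le_sqrt ?_)
      exact Finset.sum_le_sum_of_subset_of_nonneg
        (Finset.filter_subset_filter _ (Finset.subset_insert _ _)) fun i _ _ => hw i
    have hS : 0 ≤ ∑ j ∈ s, w j := Finset.sum_nonneg fun i _ => hw i
    rw [Finset.sum_insert ha]
    set S := ∑ j ∈ s, w j
    -- The telescoping step: w = (√(w + S) - √S)(√(w + S) + √S), and the last factor is at most 2√(w
    -- + S).
    have h2 : w a / √(w a + S) ≤ 2 * (√(w a + S) - √S) := by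
      rcases (hw a).eq_or_lt with h0 | h0
      · simp [← h0]
      have hp : 0 < √(w a + S) := Real.sqrt_pos.2 (by positivity)
      rw [div_le_iff₀ hp]
      nlinarith [Real.sq_sqrt hS, Real.sq_sqrt (show 0 ≤ w a + S by positivity),
        sq_nonneg (√(w a + S) - √S)]
    linarith [h1.trans ih]

/-- The product `N_F(x_k) M_F(x_k)` of the mass of `b²` below `x_k` and the mass of `a²` above. -/
def muckenhoupt (x a b : ι → ℝ) (F : Finset ι) (k : ι) : ℝ :=
  (∑ j ∈ F with x j ≤ x k, b j ^ 2) * ∑ j ∈ F with x k ≤ x j, a j ^ 2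

theorem muckenhoupt_nonneg (x a b : ι → ℝ) (F : Finset ι) (k : ι) : 0 ≤ muckenhoupt x a b F k :=
  mul_nonneg (Finset.sum_nonneg fun _ _ => sq_nonneg _) (Finset.sum_nonneg fun _ _ => sq_nonneg _)

/-- Reversing the order exchanges the two factors. Every statement about an adjoint is thereby an
instance of the original statement for -x. -/
theorem muckenhoupt_neg (x a b : ι → ℝ) (F : Finset ι) (k : ι) :
    muckenhoupt (fun i => -x i) b a F k = muckenhoupt x a b F k := by
  simp only [muckenhoupt, neg_le_neg_iff]
  rw [mul_comm]

/-- Hardy's inequality for finite sums with weights, by Muckenhoupt's argument. -/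
theorem hardy_inequality_finset (F : Finset ι) (x a b g : ι → ℝ) {β : ℝ} (hβ : 0 ≤ β)
    (h : ∀ k ∈ F, muckenhoupt x a b F k ≤ β) :
    ∑ n ∈ F, (a n * ∑ k ∈ F with x k ≤ x n, b k * g k) ^ 2 ≤ 4 * β * ∑ k ∈ F, g k ^ 2 := by
  set N : ι → ℝ := fun k => ∑ j ∈ F with x j ≤ x k, b j ^ 2 with hN
  set M : ι → ℝ := fun k => ∑ j ∈ F with x k ≤ x j, a j ^ 2 with hM
  have hN0 (k) : 0 ≤ N k := Finset.sum_nonneg fun _ _ => sq_nonneg _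
  have hM0 (k) : 0 ≤ M k := Finset.sum_nonneg fun _ _ => sq_nonneg _
  have hNpos (k) (hk : k ∈ F) (hb : b k ≠ 0) : 0 < N k :=
    (pow_pos (abs_pos.2 hb) 2).trans_le (by
      rw [sq_abs]
      exact Finset.single_le_sum (f := fun j => b j ^ 2) (fun i _ => sq_nonneg _)
        (Finset.mem_filter.2 ⟨hk, le_rfl⟩))
  have hMpos (k) (hk : k ∈ F) (ha : a k ≠ 0) : 0 < M k :=
    (pow_pos (abs_pos.2 ha) 2).trans_le (by
      rw [sq_abs]
      exact Finset.single_le_sum (f := fun j => a j ^ 2) (fun i _ => sq_nonneg _)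
        (Finset.mem_filter.2 ⟨hk, le_rfl⟩))
  have hNM (k) (hk : k ∈ F) : √(N k) * √(M k) ≤ √β := by
    rw [← Real.sqrt_mul (hN0 k)]
    exact Real.sqrt_le_sqrt (h k hk)
  have hlow (n) : ∑ k ∈ F with x k ≤ x n, b k ^ 2 / √(N k) ≤ 2 * √(N n) := by
    refine le_trans (le_of_eq (Finset.sum_congr rfl fun k hk => ?_))
      (Finset.sum_div_sqrt_partialSum_le {k ∈ F | x k ≤ x n} x (fun k => b k ^ 2)
        fun _ => sq_nonneg _)
    rw [hN, Finset.filter_filter]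
    have := (Finset.mem_filter.1 hk).2
    congr 2
    refine Finset.sum_congr (Finset.filter_congr fun j _ => ?_) fun _ _ => rfl
    grind
  have hhigh (k) : ∑ n ∈ F with x k ≤ x n, a n ^ 2 / √(M n) ≤ 2 * √(M k) := by
    refine le_trans (le_of_eq (Finset.sum_congr rfl fun n hn => ?_))
      (Finset.sum_div_sqrt_partialSum_le {n ∈ F | x k ≤ x n} (fun i => -x i) (fun k => a k ^ 2)
        fun _ => sq_nonneg _)
    rw [hM, Finset.filter_filter]
    have := (Finset.mem_filter.1 hn).2
    congr 2
    refine Finset.sum_congr (Finset.filter_congr fun j _ => ?_) fun _ _ => rfl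
    grind
  -- Cauchy–Schwarz with b_k g_k = (b_k N_k^(-1/4)) (g_k N_k^(1/4)). The first factor contributes
  -- 2√N_n, which is at most 2√β/√M_n; since M_n may vanish when a_n = 0, that case is separate.
  have hrow (n) (hn : n ∈ F) : (a n * ∑ k ∈ F with x k ≤ x n, b k * g k) ^ 2 ≤
      ∑ k ∈ F with x k ≤ x n, 2 * √β * (g k ^ 2 * √(N k)) * (a n ^ 2 / √(M n)) := by
    rcases eq_or_ne (a n) 0 with ha | ha
    · simp [ha]
    have hcs : (∑ k ∈ F with x k ≤ x n, b k * g k) ^ 2 ≤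
        (∑ k ∈ F with x k ≤ x n, b k ^ 2 / √(N k)) *
          ∑ k ∈ F with x k ≤ x n, g k ^ 2 * √(N k) := by
      refine Finset.sum_sq_le_sum_mul_sum_of_sq_le_mul _ (fun k _ => by positivity)
        (fun k _ => by positivity) fun k hk => ?_
      rcases eq_or_ne (b k) 0 with hb | hb
      · simp [hb]
      have := Real.sqrt_pos.2 (hNpos k (Finset.mem_filter.1 hk).1 hb)
      refine le_of_eq ?_
      field_simp
    have hMn := Real.sqrt_pos.2 (hMpos n hn ha)
    have hS : 0 ≤ ∑ k ∈ F with x k ≤ x n, g k ^ 2 * √(N k) :=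
      Finset.sum_nonneg fun _ _ => by positivity
    rw [← Finset.sum_mul, ← Finset.mul_sum, mul_pow]
    calc a n ^ 2 * (∑ k ∈ F with x k ≤ x n, b k * g k) ^ 2
        ≤ a n ^ 2 * (2 * √(N n) * ∑ k ∈ F with x k ≤ x n, g k ^ 2 * √(N k)) := by
          gcongr
          exact hcs.trans (mul_le_mul_of_nonneg_right (hlow n) hS)
      _ ≤ a n ^ 2 * (2 * (√β / √(M n)) * ∑ k ∈ F with x k ≤ x n, g k ^ 2 * √(N k)) := by
          gcongr
          rw [le_div_iff₀ hMn]
          exact hNM n hn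
      _ = _ := by ring
  calc ∑ n ∈ F, (a n * ∑ k ∈ F with x k ≤ x n, b k * g k) ^ 2
      ≤ ∑ n ∈ F, ∑ k ∈ F with x k ≤ x n,
          2 * √β * (g k ^ 2 * √(N k)) * (a n ^ 2 / √(M n)) := Finset.sum_le_sum hrow
    _ = ∑ k ∈ F, ∑ n ∈ F with x k ≤ x n,
          2 * √β * (g k ^ 2 * √(N k)) * (a n ^ 2 / √(M n)) := by
        simp only [Finset.sum_filter]
        exact Finset.sum_comm
    -- After the exchange of sums, the inner sum is again of the form w/√W, now for the reversed
    -- order, and gives the second factor 2.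
    _ ≤ ∑ k ∈ F, 4 * β * g k ^ 2 := by
        refine Finset.sum_le_sum fun k hk => ?_
        rw [← Finset.mul_sum]
        calc _ ≤ 2 * √β * (g k ^ 2 * √(N k)) * (2 * √(M k)) := by
              gcongr
              exact hhigh k
          _ = 4 * √β * g k ^ 2 * (√(N k) * √(M k)) := by ring
          _ ≤ 4 * √β * g k ^ 2 * √β := by
              gcongr
              exact hNM k hk
          _ = 4 * (√β * √β) * g k ^ 2 := by ring
          _ = _ := by rw [Real.mul_self_sqrt hβ]
    _ = _ := by rw [Finset.mul_sum]

/-- The kernel `d_n d_k / (x_n + x_k)` is controlled by the Hardy operator. -/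
theorem sum_sum_div_add_le (F : Finset ι) (x d g : ι → ℝ) (hx : ∀ i, 0 < x i)
    (hd : ∀ i, 0 ≤ d i) (hg : ∀ i, 0 ≤ g i) {β : ℝ} (hβ : 0 ≤ β)
    (h : ∀ k ∈ F, muckenhoupt x (fun n => d n / x n) d F k ≤ β) :
    ∑ n ∈ F, ∑ k ∈ F, g n * g k * (d n * d k / (x n + x k)) ≤ 4 * √β * ∑ k ∈ F, g k ^ 2 := by
  -- Bounding x_n + x_k below by its larger term leaves a Hardy entry or a transposed one. Ties are
  -- counted twice, which is harmless; the two double sums agree after swapping n and k.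
  have hterm (n k : ι) : g n * g k * (d n * d k / (x n + x k)) ≤
      (if x k ≤ x n then g n * (d n / x n * (d k * g k)) else 0) +
        if x n ≤ x k then g k * (d k / x k * (d n * g n)) else 0 := by
    have hn := hx n
    have hk := hx k
    have := hd n
    have := hd k
    have := hg n
    have := hg k
    have hp1 : 0 ≤ g k * (d k / x k * (d n * g n)) := by positivity
    have hp2 : 0 ≤ g n * (d n / x n * (d k * g k)) := by positivity
    have h1 : g n * g k * (d n * d k / (x n + x k)) ≤ g n * (d n / x n * (d k * g k)) := by
      calc g n * g k * (d n * d k / (x n + x k)) ≤ g n * g k * (d n * d k / x n) := by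
            gcongr; linarith
        _ = _ := by ring
    have h2 : g n * g k * (d n * d k / (x n + x k)) ≤ g k * (d k / x k * (d n * g n)) := by
      calc g n * g k * (d n * d k / (x n + x k)) ≤ g n * g k * (d n * d k / x k) := by
            gcongr; linarith
        _ = _ := by ring
    split_ifs with h3 h4 h4 <;> linarith
  have hhalf : ∑ n ∈ F, ∑ k ∈ F, (if x k ≤ x n then g n * (d n / x n * (d k * g k)) else 0) ≤
      2 * √β * ∑ k ∈ F, g k ^ 2 := by
    have hG : 0 ≤ ∑ k ∈ F, g k ^ 2 := Finset.sum_nonneg fun _ _ => sq_nonneg _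
    have hcs := Finset.sum_mul_sq_le_sq_mul_sq F g
      fun n => d n / x n * ∑ k ∈ F with x k ≤ x n, d k * g k
    have hh := hardy_inequality_finset F x (fun n => d n / x n) d g hβ h
    have heq : ∑ n ∈ F, ∑ k ∈ F, (if x k ≤ x n then g n * (d n / x n * (d k * g k)) else 0) =
        ∑ n ∈ F, g n * (d n / x n * ∑ k ∈ F with x k ≤ x n, d k * g k) := by
      simp only [Finset.mul_sum, Finset.sum_filter, mul_ite, mul_zero]
    rw [heq]
    refine abs_le_of_sq_le_sq' ?_ (by positivity) |>.2
    calc _ ≤ _ := hcs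
      _ ≤ (∑ k ∈ F, g k ^ 2) * (4 * β * ∑ k ∈ F, g k ^ 2) := by gcongr
      _ = 4 * β * (∑ k ∈ F, g k ^ 2) ^ 2 := by ring
      _ = 4 * √β ^ 2 * (∑ k ∈ F, g k ^ 2) ^ 2 := by rw [Real.sq_sqrt hβ]
      _ = _ := by ring
  calc _ ≤ ∑ n ∈ F, ∑ k ∈ F, ((if x k ≤ x n then g n * (d n / x n * (d k * g k)) else 0) +
        if x n ≤ x k then g k * (d k / x k * (d n * g n)) else 0) :=
        Finset.sum_le_sum fun n _ => Finset.sum_le_sum fun k _ => hterm n k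
    _ = (∑ n ∈ F, ∑ k ∈ F, (if x k ≤ x n then g n * (d n / x n * (d k * g k)) else 0)) +
        ∑ n ∈ F, ∑ k ∈ F, (if x k ≤ x n then g n * (d n / x n * (d k * g k)) else 0) := by
        simp only [Finset.sum_add_distrib]
        congr 1
        exact Finset.sum_comm
    _ ≤ _ := by linarith

end FiniteHardy

/-! ### Compactness of T, T* and T*T in Hilbert spaces. -/

section Compactness

variable {𝕜 : Type*} [RCLike 𝕜] {E F : Type*} [NormedAddCommGroup E] [InnerProductSpace 𝕜 E]
  [CompleteSpace E] [NormedAddCommGroup F] [InnerProductSpace 𝕜 F] [CompleteSpace F]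

open ContinuousLinearMap

/-- From ‖Tf‖² = ⟨T*Tf, f⟩ ≤ ‖T*Tf‖ ‖f‖, a finite net for the image of the unit ball under T*T
yields one for its image under T. -/
theorem IsCompactOperator.of_adjoint_comp_self {T : E →L[𝕜] F}
    (h : IsCompactOperator (adjoint T ∘L T)) : IsCompactOperator T := by
  have hK := h.isCompact_closure_image_ball (f := (adjoint T ∘L T : E →L[𝕜] E).toLinearMap) 1
  have htb : TotallyBounded ((adjoint T ∘L T) '' Metric.ball 0 1) :=
    hK.totallyBounded.subset subset_closure
  refine (isCompactOperator_iff_isCompact_closure_image_ball T.toLinearMap one_pos).2 ?_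
  refine (TotallyBounded.closure ?_).isCompact_of_isClosed isClosed_closure
  refine Metric.totallyBounded_of_finite_discretization fun ε hε => ?_
  -- Points with the same centre have T*T-images within ε²/4 and differ by at most 2, so their
  -- T-images have squared distance below ε²/2.
  obtain ⟨t, ht, htc⟩ := Metric.totallyBounded_iff.1 htb (ε ^ 2 / 8) (by positivity)
  have hex (y : ((T : E →ₗ[𝕜] F) '' Metric.ball 0 1 : Set F)) :
      ∃ f, ‖f‖ < 1 ∧ T f = y ∧ ∃ c : t, dist ((adjoint T ∘L T) f) c < ε ^ 2 / 8 := by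
    obtain ⟨y, f, hf, rfl⟩ := y
    obtain ⟨c, hc, hfc⟩ := Set.mem_iUnion₂.1 (htc ⟨f, hf, rfl⟩)
    exact ⟨f, by simpa using hf, rfl, ⟨c, hc⟩, hfc⟩
  choose f hf1 hfy c hc using hex
  obtain ⟨m, ⟨e⟩⟩ := finite_iff_exists_equiv_fin.1 ht.to_subtype
  refine ⟨ULift (Fin m), inferInstance, fun y => ⟨e (c y)⟩, fun y z hyz => ?_⟩
  replace hyz : c y = c z := e.injective (ULift.up_injective hyz)
  have h1 : ‖(adjoint T ∘L T) (f y - f z)‖ < ε ^ 2 / 4 := by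
    rw [map_sub, ← dist_eq_norm]
    have h2 := hc z
    rw [← hyz] at h2
    linarith [hc y, dist_triangle_right ((adjoint T ∘L T) (f y)) ((adjoint T ∘L T) (f z)) (c y)]
  have h3 : ‖f y - f z‖ ≤ 2 := by linarith [norm_sub_le (f y) (f z), hf1 y, hf1 z]
  rw [← hfy, ← hfy, dist_eq_norm, ← map_sub]
  refine lt_of_pow_lt_pow_left₀ 2 hε.le ?_
  have h4 := apply_norm_sq_eq_inner_adjoint_left T (f y - f z)
  have h5 := (RCLike.re_le_norm _).trans
    (norm_inner_le_norm (𝕜 := 𝕜) ((adjoint T ∘L T) (f y - f z)) (f y - f z))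
  have h6 : ‖(adjoint T ∘L T) (f y - f z)‖ * ‖f y - f z‖ ≤ ε ^ 2 / 4 * 2 := by gcongr
  have h7 : 0 < ε ^ 2 := by positivity
  rw [h4]
  exact (h5.trans h6).trans_lt (by linarith)

theorem isCompactOperator_adjoint_comp_self_iff {T : E →L[𝕜] F} :
    IsCompactOperator (adjoint T ∘L T) ↔ IsCompactOperator T :=
  ⟨.of_adjoint_comp_self, fun h => h.clm_comp (adjoint T)⟩

/-- The previous criterion applied to T*, since T**T* = TT* is compact. -/
theorem IsCompactOperator.adjoint {T : E →L[𝕜] F} (h : IsCompactOperator T) :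
    IsCompactOperator (ContinuousLinearMap.adjoint T) := by
  refine .of_adjoint_comp_self ?_
  rw [adjoint_adjoint]
  exact h.comp_clm (ContinuousLinearMap.adjoint T)

/-- Schauder's theorem in Hilbert spaces. -/
theorem isCompactOperator_adjoint_iff {T : E →L[𝕜] F} :
    IsCompactOperator (ContinuousLinearMap.adjoint T) ↔ IsCompactOperator T :=
  ⟨fun h => by simpa using h.adjoint, .adjoint⟩

end Compactness

/-! ### Partially defined operators represented by continuous linear maps. -/

section PartialMaps

variable {𝕜 : Type*} [RCLike 𝕜] {E F G : Type*} [NormedAddCommGroup E] [NormedSpace 𝕜 E]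
  [NormedAddCommGroup F] [NormedSpace 𝕜 F] [NormedAddCommGroup G] [NormedSpace 𝕜 G]

/-- `T` is everywhere defined and coincides with the continuous linear map `S`. -/
def Represents (T : E →ₗ.[𝕜] F) (S : E →L[𝕜] F) : Prop :=
  ∀ f : E, ∃ h : f ∈ T.domain, T ⟨f, h⟩ = S f

theorem Represents.domain_eq_top {T : E →ₗ.[𝕜] F} {S : E →L[𝕜] F} (h : Represents T S) :
    T.domain = ⊤ :=
  (Submodule.eq_top_iff').2 fun f => (h f).1

theorem Represents.apply {T : E →ₗ.[𝕜] F} {S : E →L[𝕜] F} (h : Represents T S) (f : T.domain) :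
    T f = S f :=
  (h f).2

theorem isBoundedOp_iff_exists_represents {T : E →ₗ.[𝕜] F} :
    IsBoundedOp T ↔ ∃ S : E →L[𝕜] F, Represents T S := by
  constructor
  · rintro ⟨hT, c, hc⟩
    have hmem (f : E) : f ∈ T.domain := by rw [hT]; trivial
    refine ⟨LinearMap.mkContinuous
      (T.toFun ∘ₗ (LinearMap.id : E →ₗ[𝕜] E).codRestrict T.domain hmem) c fun f => ?_,
      fun f => ⟨hmem f, rfl⟩⟩
    exact hc ⟨f, hmem f⟩
  · rintro ⟨S, hS⟩
    refine ⟨hS.domain_eq_top, ‖S‖, fun f => ?_⟩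
    rw [hS.apply]
    exact S.le_opNorm f

theorem Represents.isBoundedOp {T : E →ₗ.[𝕜] F} {S : E →L[𝕜] F} (h : Represents T S) :
    IsBoundedOp T :=
  isBoundedOp_iff_exists_represents.2 ⟨S, h⟩

theorem Represents.isCompactOp_iff {T : E →ₗ.[𝕜] F} {S : E →L[𝕜] F} (h : Represents T S) :
    IsCompactOp T ↔ IsCompactOperator S := by
  constructor
  · rintro ⟨_, hc⟩
    have h1 := hc.comp_clm ((ContinuousLinearMap.id 𝕜 E).codRestrict T.domain fun f => (h f).1)
    have h2 : T ∘ ((ContinuousLinearMap.id 𝕜 E).codRestrict T.domain fun f => (h f).1) = S :=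
      funext fun f => (h f).2
    rwa [h2] at h1
  · intro hc
    have h1 := hc.comp_clm T.domain.subtypeL
    have h2 : S ∘ T.domain.subtypeL = T := funext fun f => (h.apply f).symm
    rw [h2] at h1
    exact ⟨h.domain_eq_top, h1⟩

theorem IsCompactOp.isBoundedOp {T : E →ₗ.[𝕜] F} (h : IsCompactOp T) : IsBoundedOp T := by
  have hcont : Continuous T.toFun := h.2.continuous
  refine ⟨h.1, ‖(⟨T.toFun, hcont⟩ : T.domain →L[𝕜] F)‖, fun f => ?_⟩
  exact (⟨T.toFun, hcont⟩ : T.domain →L[𝕜] F).le_opNorm f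

theorem mem_domain_compOp {T : F →ₗ.[𝕜] G} {S : E →ₗ.[𝕜] F} {f : E} :
    f ∈ (compOp T S).domain ↔ ∃ h : f ∈ S.domain, S ⟨f, h⟩ ∈ T.domain := by
  constructor
  · rintro ⟨⟨g, hg, rfl⟩, hf⟩
    exact ⟨hf, hg⟩
  · rintro ⟨h, h'⟩
    exact ⟨⟨⟨f, h⟩, h', rfl⟩, h⟩

theorem compOp_apply {T : F →ₗ.[𝕜] G} {S : E →ₗ.[𝕜] F} {f : E} (h : f ∈ S.domain)
    (h' : S ⟨f, h⟩ ∈ T.domain) (hc : f ∈ (compOp T S).domain) :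
    compOp T S ⟨f, hc⟩ = T ⟨S ⟨f, h⟩, h'⟩ :=
  rfl

theorem Represents.compOp {T : F →ₗ.[𝕜] G} {S : E →ₗ.[𝕜] F} {T' : F →L[𝕜] G} {S' : E →L[𝕜] F}
    (hT : Represents T T') (hS : Represents S S') : Represents (compOp T S) (T' ∘L S') := by
  intro f
  have hmem : f ∈ (_root_.compOp T S).domain := mem_domain_compOp.2 ⟨(hS f).1, (hT _).1⟩
  refine ⟨hmem, ?_⟩
  rw [compOp_apply (hS f).1 (hT _).1, hT.apply]
  exact congrArg T' (hS f).2

end PartialMaps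

/-! ### Coordinate projections and compactness in ℓ². -/

section EllTwo

variable {𝕜 : Type*} [RCLike 𝕜]

theorem EllTwo.sum_sq_le (f : EllTwo 𝕜) (s : Finset ℕ) : ∑ n ∈ s, ‖f n‖ ^ 2 ≤ ‖f‖ ^ 2 := by
  simpa using lp.sum_rpow_le_norm_rpow (p := 2) (by simp) f s

theorem EllTwo.norm_le_of_forall_sum_sq_le {f : EllTwo 𝕜} {c : ℝ} (hc : 0 ≤ c)
    (h : ∀ s : Finset ℕ, ∑ n ∈ s, ‖f n‖ ^ 2 ≤ c ^ 2) : ‖f‖ ≤ c :=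
  lp.norm_le_of_forall_sum_le (p := 2) (by simp) hc fun s => by simpa using h s

theorem EllTwo.memℓp_of_forall_sum_sq_le {f : ℕ → 𝕜} {c : ℝ}
    (h : ∀ s : Finset ℕ, ∑ n ∈ s, ‖f n‖ ^ 2 ≤ c) : Memℓp f 2 :=
  memℓp_gen' (C := c) fun s => by simpa using h s

theorem EllTwo.inner_single_one (f : EllTwo 𝕜) (n : ℕ) :
    inner 𝕜 (lp.single 2 n (1 : 𝕜) : EllTwo 𝕜) f = f n := by
  rw [lp.inner_single_left]
  simp

/-- The coordinate projection onto the indices in `s`. -/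
def coordProj (𝕜 : Type*) [RCLike 𝕜] (s : Finset ℕ) : EllTwo 𝕜 →L[𝕜] EllTwo 𝕜 :=
  ∑ i ∈ s, (lp.singleContinuousLinearMap 𝕜 (fun _ : ℕ => 𝕜) 2 i) ∘L
    (lp.evalCLM 𝕜 (fun _ : ℕ => 𝕜) 2 i)

theorem coordProj_eq_sum (s : Finset ℕ) (f : EllTwo 𝕜) :
    coordProj 𝕜 s f = ∑ i ∈ s, lp.single 2 i (f i) := by
  simp only [coordProj, FunLike.coe_sum, Finset.sum_apply]
  rfl

theorem coordProj_apply (s : Finset ℕ) (f : EllTwo 𝕜) (n : ℕ) :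
    coordProj 𝕜 s f n = if n ∈ s then f n else 0 := by
  rw [coordProj_eq_sum, lp.coeFn_sum, Finset.sum_apply]
  simp only [lp.coeFn_single, Finset.sum_pi_single]

theorem isCompactOperator_coordProj (s : Finset ℕ) : IsCompactOperator (coordProj 𝕜 s) := by
  have h (i : ℕ) : IsCompactOperator ((lp.singleContinuousLinearMap 𝕜 (fun _ : ℕ => 𝕜) 2 i) ∘L
      (lp.evalCLM 𝕜 (fun _ : ℕ => 𝕜) 2 i)) := by
    have h1 : IsCompactOperator (lp.evalCLM 𝕜 (fun _ : ℕ => 𝕜) 2 i) :=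
      (isCompactOperator_id (E := 𝕜)).comp_clm (lp.evalCLM 𝕜 (fun _ : ℕ => 𝕜) 2 i)
    exact h1.clm_comp (lp.singleContinuousLinearMap 𝕜 (fun _ : ℕ => 𝕜) 2 i)
  exact Submodule.sum_mem (compactOperator (RingHom.id 𝕜) (EllTwo 𝕜) (EllTwo 𝕜)) fun i _ => h i

theorem norm_sub_coordProj_le (s : Finset ℕ) (f : EllTwo 𝕜) : ‖f - coordProj 𝕜 s f‖ ≤ ‖f‖ := by
  refine lp.norm_mono two_ne_zero fun n => ?_
  rw [lp.coeFn_sub, Pi.sub_apply, coordProj_apply]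
  split_ifs <;> simp

theorem sum_sq_le_norm_sub_coordProj_sq {s t : Finset ℕ} (h : Disjoint t s) (f : EllTwo 𝕜) :
    ∑ n ∈ t, ‖f n‖ ^ 2 ≤ ‖f - coordProj 𝕜 s f‖ ^ 2 := by
  refine le_trans (le_of_eq (Finset.sum_congr rfl fun n hn => ?_))
    (EllTwo.sum_sq_le (f - coordProj 𝕜 s f) t)
  rw [lp.coeFn_sub, Pi.sub_apply, coordProj_apply, if_neg (Finset.disjoint_left.1 h hn), sub_zero]

theorem tendsto_norm_sub_coordProj (f : EllTwo 𝕜) :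
    Tendsto (fun s => ‖f - coordProj 𝕜 s f‖) atTop (𝓝 0) := by
  have h : Tendsto (fun s : Finset ℕ => ∑ i ∈ s, lp.single 2 i (f i)) atTop (𝓝 f) :=
    lp.hasSum_single (p := 2) (by simp) f
  simp only [coordProj_eq_sum]
  simpa using ((tendsto_const_nhds (x := f)).sub h).norm

variable {E F : Type*} [NormedAddCommGroup E] [NormedSpace 𝕜 E]
  [NormedAddCommGroup F] [NormedSpace 𝕜 F] [CompleteSpace F]

theorem isCompactOperator_of_forall_exists_norm_sub_le {T : E →L[𝕜] F}
    (h : ∀ ε > 0, ∃ K : E →L[𝕜] F, IsCompactOperator K ∧ ‖T - K‖ ≤ ε) : IsCompactOperator T := by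
  have hcl : IsClosed {f : E →L[𝕜] F | IsCompactOperator f} := isClosed_setOfPred_isCompactOperator
  refine hcl.closure_subset_iff.2 subset_rfl (Metric.mem_closure_iff.2 fun ε hε => ?_)
  obtain ⟨K, hK, hTK⟩ := h (ε / 2) (by positivity)
  exact ⟨K, hK, by rw [dist_eq_norm]; linarith⟩

/-- The rows of a compact operator into `ℓ²` are uniformly small outside a finite set. -/
theorem IsCompactOperator.exists_norm_sub_coordProj_le {T : E →L[𝕜] EllTwo 𝕜}
    (hT : IsCompactOperator T) {ε : ℝ} (hε : 0 < ε) :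
    ∃ s : Finset ℕ, ∀ f, ‖T f - coordProj 𝕜 s (T f)‖ ≤ ε * ‖f‖ := by
  have hK := hT.isCompact_closure_image_closedBall (f := T.toLinearMap) 1
  obtain ⟨t, ht, htc⟩ := Metric.totallyBounded_iff.1
    (hK.totallyBounded.subset subset_closure) (ε / 2) (by positivity)
  -- One finite set of coordinates serves all points of the net; as 1 - P is a contraction, it then
  -- serves the whole image of the unit ball.
  have hev : ∀ᶠ s in atTop, ∀ y ∈ t, ‖y - coordProj 𝕜 s y‖ < ε / 2 :=
    (Filter.eventually_all_finite ht).2 fun y _ =>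
      (tendsto_norm_sub_coordProj y).eventually_lt_const (by positivity)
  obtain ⟨s, hs⟩ := hev.exists
  refine ⟨s, fun f => ?_⟩
  have hle : ‖T - coordProj 𝕜 s ∘L T‖ ≤ ε := by
    let _ : NormedSpace ℝ E := NormedSpace.restrictScalars ℝ 𝕜 E
    refine ContinuousLinearMap.opNorm_le_of_unit_norm hε.le fun f hf => ?_
    obtain ⟨y, hy, hfy⟩ := Set.mem_iUnion₂.1 (htc ⟨f, by simp [hf], rfl⟩)
    have h1 : ‖(T f - y) - coordProj 𝕜 s (T f - y)‖ ≤ ‖T f - y‖ := norm_sub_coordProj_le s _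
    have h2 : ‖T f - y‖ < ε / 2 := by simpa [dist_eq_norm] using hfy
    have h3 := hs y hy
    have h4 : (T - coordProj 𝕜 s ∘L T) f =
        ((T f - y) - coordProj 𝕜 s (T f - y)) + (y - coordProj 𝕜 s y) := by
      simp only [sub_apply, ContinuousLinearMap.comp_apply, map_sub]
      abel
    rw [h4]
    linarith [norm_add_le ((T f - y) - coordProj 𝕜 s (T f - y)) (y - coordProj 𝕜 s y)]
  exact (T - coordProj 𝕜 s ∘L T).le_of_opNorm_le hle f

end EllTwo

/-! ### Lower bounds from test vectors. -/

section TestVectors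

variable {𝕜 : Type*} [RCLike 𝕜]

/-- The finitely supported vector with the real entries `b j`, `j ∈ s`. -/
def testVec (𝕜 : Type*) [RCLike 𝕜] (s : Finset ℕ) (b : ℕ → ℝ) : EllTwo 𝕜 :=
  ∑ j ∈ s, (b j : 𝕜) • lp.single 2 j (1 : 𝕜)

theorem testVec_apply (s : Finset ℕ) (b : ℕ → ℝ) (n : ℕ) :
    testVec 𝕜 s b n = ((if n ∈ s then b n else 0 : ℝ) : 𝕜) := by
  rw [testVec, lp.coeFn_sum, Finset.sum_apply]
  simp [lp.coeFn_smul, Pi.single_apply, RCLike.real_smul_eq_coe_mul]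
  split_ifs <;> simp

theorem norm_testVec_sq (s : Finset ℕ) (b : ℕ → ℝ) : ‖testVec 𝕜 s b‖ ^ 2 = ∑ j ∈ s, b j ^ 2 := by
  have h := lp.norm_sum_single (p := 2) (by simp) (fun j => (b j : 𝕜)) s
  have h2 : testVec 𝕜 s b = ∑ j ∈ s, lp.single 2 j (b j : 𝕜) := by
    refine Finset.sum_congr rfl fun j _ => ?_
    rw [← lp.single_smul, smul_eq_mul, mul_one]
  rw [h2]
  simpa using h

/-- If the entries of the matrix of `T` dominate `a_n b_j` for `x_j ≤ x_n`, then bounds on the rows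
of `T` yield bounds on the Muckenhoupt products. -/
theorem muckenhoupt_le_of_entries {T : EllTwo 𝕜 →L[𝕜] EllTwo 𝕜} {x a b : ℕ → ℝ}
    (ha : ∀ i, 0 ≤ a i) (hb : ∀ i, 0 ≤ b i) {κ : ℝ} (hκ : 0 ≤ κ)
    (hT : ∀ n j, x j ≤ x n → ∃ t : ℝ, T (lp.single 2 j 1) n = t ∧ κ * (a n * b j) ≤ t)
    {F : Finset ℕ} {k : ℕ} {c : ℝ}
    (hc : ∀ f, ∑ n ∈ F with x k ≤ x n, ‖T f n‖ ^ 2 ≤ c ^ 2 * ‖f‖ ^ 2) :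
    κ ^ 2 * muckenhoupt x a b F k ≤ c ^ 2 := by
  set N := ∑ j ∈ F with x j ≤ x k, b j ^ 2 with hN
  have hN0 : 0 ≤ N := Finset.sum_nonneg fun _ _ => sq_nonneg _
  -- The test vector is b on {x_j ≤ x_k}, with squared norm N. Each row with x_n ≥ x_k has value at
  -- least κ a_n N, so summing squares gives κ² N² M ≤ c² N, and one factor N cancels unless N = 0.
  have hrow : ∀ n ∈ ({n ∈ F | x k ≤ x n} : Finset ℕ),
      κ ^ 2 * N ^ 2 * a n ^ 2 ≤ ‖T (testVec 𝕜 {j ∈ F | x j ≤ x k} b) n‖ ^ 2 := by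
    intro n hn
    have hkn := (Finset.mem_filter.1 hn).2
    have hex : ∀ j, ∃ t : ℝ, x j ≤ x k → T (lp.single 2 j 1) n = t ∧ κ * (a n * b j) ≤ t := by
      intro j
      by_cases hj : x j ≤ x k
      · obtain ⟨t, ht⟩ := hT n j (hj.trans hkn)
        exact ⟨t, fun _ => ht⟩
      · exact ⟨0, fun h => absurd h hj⟩
    choose t ht using hex
    have hval : T (testVec 𝕜 {j ∈ F | x j ≤ x k} b) n =
        ((∑ j ∈ F with x j ≤ x k, b j * t j : ℝ) : 𝕜) := by
      rw [testVec, map_sum, lp.coeFn_sum, Finset.sum_apply]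
      push_cast
      refine Finset.sum_congr rfl fun j hj => ?_
      rw [map_smul, lp.coeFn_smul, Pi.smul_apply, (ht j (Finset.mem_filter.1 hj).2).1, smul_eq_mul]
    have hge : κ * a n * N ≤ ∑ j ∈ F with x j ≤ x k, b j * t j := by
      rw [hN, Finset.mul_sum]
      refine Finset.sum_le_sum fun j hj => ?_
      calc κ * a n * b j ^ 2 = b j * (κ * (a n * b j)) := by ring
        _ ≤ _ := mul_le_mul_of_nonneg_left (ht j (Finset.mem_filter.1 hj).2).2 (hb j)
    have h0 : 0 ≤ κ * a n * N := mul_nonneg (mul_nonneg hκ (ha n)) hN0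
    rw [hval, RCLike.norm_ofReal, sq_abs]
    calc κ ^ 2 * N ^ 2 * a n ^ 2 = (κ * a n * N) ^ 2 := by ring
      _ ≤ _ := pow_le_pow_left₀ h0 hge 2
  have hsum := (Finset.sum_le_sum hrow).trans (hc _)
  rw [norm_testVec_sq, ← Finset.mul_sum] at hsum
  have hdef : muckenhoupt x a b F k = N * ∑ j ∈ F with x k ≤ x j, a j ^ 2 := rfl
  rcases hN0.eq_or_lt with h0 | h0
  · rw [hdef, ← h0]
    simpa using sq_nonneg c
  · refine le_of_mul_le_mul_right ?_ h0
    rw [hdef]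
    exact le_trans (le_of_eq (by ring)) hsum

theorem muckenhoupt_le_opNorm_sq {T : EllTwo 𝕜 →L[𝕜] EllTwo 𝕜} {x a b : ℕ → ℝ}
    (ha : ∀ i, 0 ≤ a i) (hb : ∀ i, 0 ≤ b i) {κ : ℝ} (hκ : 0 ≤ κ)
    (hT : ∀ n j, x j ≤ x n → ∃ t : ℝ, T (lp.single 2 j 1) n = t ∧ κ * (a n * b j) ≤ t)
    (F : Finset ℕ) (k : ℕ) : κ ^ 2 * muckenhoupt x a b F k ≤ ‖T‖ ^ 2 := by
  refine muckenhoupt_le_of_entries ha hb hκ hT fun f => ?_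
  rw [← mul_pow]
  exact (EllTwo.sum_sq_le _ _).trans (pow_le_pow_left₀ (norm_nonneg _) (T.le_opNorm f) 2)

/-- The Muckenhoupt products tend to zero along the index. -/
def MuckenhouptVanishing (x a b : ℕ → ℝ) : Prop :=
  ∀ ε > 0, ∀ᶠ k in atTop, ∀ F : Finset ℕ, muckenhoupt x a b F k ≤ ε

/-- Compactness makes the rows outside some finite s small. Each n ∈ s satisfies x_k ≤ x_n for
finitely many k only, so for large k the rows with x_n ≥ x_k all avoid s. -/
theorem MuckenhouptVanishing.of_isCompactOperator {T : EllTwo 𝕜 →L[𝕜] EllTwo 𝕜} {x a b : ℕ → ℝ}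
    (ha : ∀ i, 0 ≤ a i) (hb : ∀ i, 0 ≤ b i) {κ : ℝ} (hκ : 0 < κ)
    (hT : ∀ n j, x j ≤ x n → ∃ t : ℝ, T (lp.single 2 j 1) n = t ∧ κ * (a n * b j) ≤ t)
    (hc : IsCompactOperator T) (hx : ∀ n, {k | x k ≤ x n}.Finite) :
    MuckenhouptVanishing x a b := by
  intro ε hε
  obtain ⟨s, hs⟩ := hc.exists_norm_sub_coordProj_le (ε := κ * √ε) (by positivity)
  have hev : ∀ᶠ k in atTop, ∀ n ∈ s, ¬ x k ≤ x n := by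
    refine (Filter.eventually_all_finset s).2 fun n _ => ?_
    rw [← Nat.cofinite_eq_atTop]
    exact (hx n).compl_mem_cofinite
  filter_upwards [hev] with k hk F
  have h := muckenhoupt_le_of_entries (F := F) (k := k) (c := κ * √ε) ha hb hκ.le hT fun f => by
    rw [← mul_pow]
    refine (sum_sq_le_norm_sub_coordProj_sq (s := s) ?_ _).trans
      (pow_le_pow_left₀ (norm_nonneg _) (hs f) 2)
    exact Finset.disjoint_left.2 fun n hn hns => hk n hns (Finset.mem_filter.1 hn).2
  rw [mul_pow, Real.sq_sqrt hε.le] at h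
  exact le_of_mul_le_mul_left h (by positivity)

end TestVectors

/-! ### The discrete Hardy operator, its adjoint and their composition. -/

section Hardy

variable {𝕜 : Type*} [RCLike 𝕜] {x a b : ℕ → ℝ}

/-- The discrete Hardy operator `f ↦ (a_n ∑_{x_k ≤ x_n} b_k f_k)_n`. -/
def hardyOp (𝕜 : Type*) [RCLike 𝕜] (x a b : ℕ → ℝ) : EllTwo 𝕜 →ₗ.[𝕜] EllTwo 𝕜 :=
  summationOp 𝕜 (fun n k => x k ≤ x n) a b

theorem mem_domain_hardyOp {f : EllTwo 𝕜} :
    f ∈ (hardyOp 𝕜 x a b).domain ↔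
      (∀ n, Summable fun k : {k : ℕ // x k ≤ x n} => (b k : 𝕜) * f k) ∧
        Memℓp (fun n => (a n : 𝕜) * ∑' k : {k : ℕ // x k ≤ x n}, (b k : 𝕜) * f k) 2 :=
  Iff.rfl

theorem hardyOp_apply {f : EllTwo 𝕜} (h : f ∈ (hardyOp 𝕜 x a b).domain) (n : ℕ) :
    hardyOp 𝕜 x a b ⟨f, h⟩ n = (a n : 𝕜) * ∑' k : {k : ℕ // x k ≤ x n}, (b k : 𝕜) * f k :=
  rfl

theorem Represents.hardyOp_apply {W : EllTwo 𝕜 →L[𝕜] EllTwo 𝕜}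
    (h : Represents (hardyOp 𝕜 x a b) W) (f : EllTwo 𝕜) (n : ℕ) :
    W f n = (a n : 𝕜) * ∑' k : {k : ℕ // x k ≤ x n}, (b k : 𝕜) * f k := by
  rw [← (h f).2]
  rfl

theorem tsum_subtype_mul_testVec (b c : ℕ → ℝ) (s : Finset ℕ) (p : ℕ → Prop) [DecidablePred p] :
    ∑' k : {k : ℕ // p k}, (b k : 𝕜) * testVec 𝕜 s c k =
      ((∑ k ∈ s with p k, b k * c k : ℝ) : 𝕜) := by
  have h := tsum_subtype {k : ℕ | p k} fun k => (b k : 𝕜) * testVec 𝕜 s c k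
  refine h.trans ?_
  rw [tsum_eq_sum (s := s), Finset.sum_filter]
  · push_cast
    refine Finset.sum_congr rfl fun k hk => ?_
    by_cases hp : p k <;> simp [Set.indicator, testVec_apply, hk, hp]
  · intro k hk
    simp [Set.indicator, testVec_apply, hk]

theorem hardyOp_testVec {s : Finset ℕ} {c : ℕ → ℝ}
    (h : testVec 𝕜 s c ∈ (hardyOp 𝕜 x a b).domain) (n : ℕ) :
    hardyOp 𝕜 x a b ⟨testVec 𝕜 s c, h⟩ n =
      ((a n * ∑ k ∈ s with x k ≤ x n, b k * c k : ℝ) : 𝕜) := by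
  rw [hardyOp_apply, tsum_subtype_mul_testVec]
  push_cast
  rfl

theorem Represents.hardyOp_single {W : EllTwo 𝕜 →L[𝕜] EllTwo 𝕜}
    (h : Represents (hardyOp 𝕜 x a b) W) (j n : ℕ) :
    W (lp.single 2 j 1) n = ((if x j ≤ x n then a n * b j else 0 : ℝ) : 𝕜) := by
  have hs : (lp.single 2 j (1 : 𝕜) : EllTwo 𝕜) = testVec 𝕜 {j} fun _ => 1 := by
    simp [testVec]
  rw [hs, ← (h _).2, hardyOp_testVec, Finset.sum_filter, Finset.sum_singleton]
  simp

/-- A finite Hardy inequality makes the Hardy operator bounded. -/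
theorem exists_represents_hardyOp {c : ℝ} (hc : 0 ≤ c) (ha : ∀ i, 0 ≤ a i) (hb : ∀ i, 0 ≤ b i)
    (hsum : ∀ n, Summable fun k : {k : ℕ // x k ≤ x n} => b k ^ 2)
    (hfin : ∀ (F : Finset ℕ) (g : ℕ → ℝ),
      ∑ n ∈ F, (a n * ∑ k ∈ F with x k ≤ x n, b k * g k) ^ 2 ≤ c ^ 2 * ∑ k ∈ F, g k ^ 2) :
    ∃ W : EllTwo 𝕜 →L[𝕜] EllTwo 𝕜, Represents (hardyOp 𝕜 x a b) W ∧ ‖W‖ ≤ c := by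
  have hsummable (f : EllTwo 𝕜) (n : ℕ) :
      Summable fun k : {k : ℕ // x k ≤ x n} => (b k : 𝕜) * f k := by
    have hf : Summable fun k => ‖f k‖ ^ 2 := by
      simpa using (lp.memℓp f).summable (p := 2) (by simp)
    refine .of_norm_bounded ((hsum n).add (hf.subtype {k | x k ≤ x n})) fun k => ?_
    rw [norm_mul, RCLike.norm_ofReal, ← sq_abs (b k)]
    simp only [Function.comp]
    nlinarith [sq_nonneg (|b k| - ‖f k‖), sq_nonneg (|b k|), sq_nonneg ‖f k‖]
  have hbound (f : EllTwo 𝕜) (F : Finset ℕ) :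
      ∑ n ∈ F, ‖(a n : 𝕜) * ∑' k : {k : ℕ // x k ≤ x n}, (b k : 𝕜) * f k‖ ^ 2 ≤
        c ^ 2 * ‖f‖ ^ 2 := by
    have hlim (n : ℕ) : Tendsto (fun G : Finset ℕ => ∑ k ∈ G with x k ≤ x n, (b k : 𝕜) * f k) atTop
        (𝓝 (∑' k : {k : ℕ // x k ≤ x n}, (b k : 𝕜) * f k)) := by
      have h := (hasSum_subtype_iff_indicator (s := {k | x k ≤ x n})
        (f := fun k => (b k : 𝕜) * f k)).1 (hsummable f n).hasSum
      refine (show Tendsto _ _ _ from h).congr fun G => ?_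
      rw [Finset.sum_filter]
      rfl
    have hlim' : Tendsto (fun G : Finset ℕ =>
        ∑ n ∈ F, ‖(a n : 𝕜) * ∑ k ∈ G with x k ≤ x n, (b k : 𝕜) * f k‖ ^ 2) atTop
        (𝓝 (∑ n ∈ F, ‖(a n : 𝕜) * ∑' k : {k : ℕ // x k ≤ x n}, (b k : 𝕜) * f k‖ ^ 2)) :=
      tendsto_finsetSum _ fun n _ => ((tendsto_const_nhds.mul (hlim n)).norm).pow 2
    -- The finite inequality needs the same set for rows and columns, so F is enlarged to the
    -- truncation G.
    refine le_of_tendsto hlim' (eventually_atTop.2 ⟨F, fun G hG => ?_⟩)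
    calc ∑ n ∈ F, ‖(a n : 𝕜) * ∑ k ∈ G with x k ≤ x n, (b k : 𝕜) * f k‖ ^ 2
        ≤ ∑ n ∈ G, ‖(a n : 𝕜) * ∑ k ∈ G with x k ≤ x n, (b k : 𝕜) * f k‖ ^ 2 :=
          Finset.sum_le_sum_of_subset_of_nonneg hG fun _ _ _ => sq_nonneg _
      _ ≤ ∑ n ∈ G, (a n * ∑ k ∈ G with x k ≤ x n, b k * ‖f k‖) ^ 2 := by
          refine Finset.sum_le_sum fun n _ => pow_le_pow_left₀ (norm_nonneg _) ?_ 2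
          rw [norm_mul, RCLike.norm_of_nonneg (ha n)]
          refine mul_le_mul_of_nonneg_left (norm_sum_le_of_le _ fun k _ => ?_) (ha n)
          rw [norm_mul, RCLike.norm_of_nonneg (hb k)]
      _ ≤ c ^ 2 * ∑ k ∈ G, ‖f k‖ ^ 2 := hfin G fun k => ‖f k‖
      _ ≤ c ^ 2 * ‖f‖ ^ 2 := by
          gcongr
          exact EllTwo.sum_sq_le f G
  have hmem (f : EllTwo 𝕜) : f ∈ (hardyOp 𝕜 x a b).domain :=
    mem_domain_hardyOp.2 ⟨hsummable f, EllTwo.memℓp_of_forall_sum_sq_le (hbound f)⟩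
  have hnorm (f : EllTwo 𝕜) : ‖hardyOp 𝕜 x a b ⟨f, hmem f⟩‖ ≤ c * ‖f‖ := by
    refine EllTwo.norm_le_of_forall_sum_sq_le (by positivity) fun F => ?_
    rw [mul_pow]
    exact hbound f F
  obtain ⟨W, hW⟩ := isBoundedOp_iff_exists_represents.1
    ⟨(Submodule.eq_top_iff').2 hmem, c, fun f => hnorm f.1⟩
  refine ⟨W, hW, W.opNorm_le_bound hc fun f => ?_⟩
  rw [← (hW f).2]
  exact hnorm f

/-- Uniform boundedness of the Muckenhoupt products. -/
def MuckenhouptBounded (x a b : ℕ → ℝ) : Prop :=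
  ∃ β : ℝ, ∀ (F : Finset ℕ) (k : ℕ), muckenhoupt x a b F k ≤ β

theorem muckenhouptBounded_neg :
    MuckenhouptBounded (fun i => -x i) b a ↔ MuckenhouptBounded x a b := by
  simp only [MuckenhouptBounded, muckenhoupt_neg]

theorem muckenhouptVanishing_neg :
    MuckenhouptVanishing (fun i => -x i) b a ↔ MuckenhouptVanishing x a b := by
  simp only [MuckenhouptVanishing, muckenhoupt_neg]

theorem MuckenhouptBounded.exists_represents (h : MuckenhouptBounded x a b)
    (ha : ∀ i, 0 ≤ a i) (hb : ∀ i, 0 ≤ b i)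
    (hsum : ∀ n, Summable fun k : {k : ℕ // x k ≤ x n} => b k ^ 2) :
    ∃ W : EllTwo 𝕜 →L[𝕜] EllTwo 𝕜, Represents (hardyOp 𝕜 x a b) W := by
  obtain ⟨β, hβ⟩ := h
  have hβ0 : 0 ≤ β := (muckenhoupt_nonneg x a b ∅ 0).trans (hβ ∅ 0)
  obtain ⟨W, hW, -⟩ := exists_represents_hardyOp (𝕜 := 𝕜) (c := √(4 * β)) (by positivity) ha hb
    hsum fun F g => by
      rw [Real.sq_sqrt (by positivity)]
      exact hardy_inequality_finset F x a b g hβ0 fun k _ => hβ F k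
  exact ⟨W, hW⟩

/-- The two matrices are transposes of each other, and unit vectors determine a continuous operator
on ℓ². -/
theorem Represents.hardyOp_adjoint {W W' : EllTwo 𝕜 →L[𝕜] EllTwo 𝕜}
    (h : Represents (hardyOp 𝕜 x a b) W) (h' : Represents (hardyOp 𝕜 (fun i => -x i) b a) W') :
    W' = ContinuousLinearMap.adjoint W := by
  refine lp.ext_continuousLinearMap (by simp) fun j => ContinuousLinearMap.ext_ring ?_
  refine lp.ext (funext fun n => ?_)
  change W' (lp.single 2 j 1) n = (ContinuousLinearMap.adjoint W) (lp.single 2 j 1) n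
  rw [← EllTwo.inner_single_one (ContinuousLinearMap.adjoint W _),
    ContinuousLinearMap.adjoint_inner_right, ← inner_conj_symm, EllTwo.inner_single_one,
    h.hardyOp_single, h'.hardyOp_single, RCLike.conj_ofReal]
  simp only [neg_le_neg_iff, mul_comm]

theorem Represents.muckenhouptBounded_of_hardyOp {W : EllTwo 𝕜 →L[𝕜] EllTwo 𝕜}
    (ha : ∀ i, 0 ≤ a i) (hb : ∀ i, 0 ≤ b i)
    (h : Represents (hardyOp 𝕜 x a b) W) : MuckenhouptBounded x a b := by
  refine ⟨‖W‖ ^ 2, fun F k => ?_⟩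
  simpa using muckenhoupt_le_opNorm_sq (κ := 1) ha hb zero_le_one
    (fun n j hjn => ⟨_, h.hardyOp_single j n, by simp [hjn]⟩) F k

/-- Only the composition is assumed bounded, so it is tested directly. On u = b restricted to {x_j ≤
x_k}, the inner operator gives a_n N for x_n ≥ x_k, and the outer one then gives at least b_n M N
for x_n ≤ x_k. Hence N (MN)² ≤ ‖S‖² N. -/
theorem Represents.muckenhouptBounded_of_comp {S : EllTwo 𝕜 →L[𝕜] EllTwo 𝕜}
    (ha : ∀ i, 0 ≤ a i) (hb : ∀ i, 0 ≤ b i)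
    (h : Represents (_root_.compOp (hardyOp 𝕜 (fun i => -x i) b a) (hardyOp 𝕜 x a b)) S) :
    MuckenhouptBounded x a b := by
  refine ⟨‖S‖, fun F k => ?_⟩
  set N := ∑ j ∈ F with x j ≤ x k, b j ^ 2 with hN
  set M := ∑ j ∈ F with x k ≤ x j, a j ^ 2 with hM
  have hN0 : 0 ≤ N := Finset.sum_nonneg fun _ _ => sq_nonneg _
  have hM0 : 0 ≤ M := Finset.sum_nonneg fun _ _ => sq_nonneg _
  set u := testVec 𝕜 {j ∈ F | x j ≤ x k} b with hu
  have hu2 : ‖u‖ ^ 2 = N := norm_testVec_sq _ _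
  obtain ⟨hdom, hS⟩ := h u
  obtain ⟨h1, h2⟩ := mem_domain_compOp.1 hdom
  rw [compOp_apply h1 h2] at hS
  set r : ℕ → ℝ := fun n => a n * ∑ j ∈ {j ∈ F | x j ≤ x k} with x j ≤ x n, b j * b j with hr
  have hr0 (n) : 0 ≤ r n := mul_nonneg (ha n) (Finset.sum_nonneg fun j _ => mul_self_nonneg _)
  have hrn (n) (hn : x k ≤ x n) : r n = a n * N := by
    rw [hr, hN]
    simp only [Finset.filter_filter, ← sq]
    congr 1
    exact Finset.sum_congr (Finset.filter_congr fun j _ => by grind) fun _ _ => rfl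
  have hrow : ∀ n ∈ ({j ∈ F | x j ≤ x k} : Finset ℕ), (b n * (M * N)) ^ 2 ≤ ‖S u n‖ ^ 2 := by
    intro n hn
    have hnk := (Finset.mem_filter.1 hn).2
    have hval : S u n = ((b n * ∑' i : {i : ℕ // -x i ≤ -x n}, a i * r i : ℝ) : 𝕜) := by
      rw [← hS, _root_.hardyOp_apply]
      simp only [hu, hardyOp_testVec]
      push_cast [hr]
      rfl
    have hsm : Summable fun i : {i : ℕ // -x i ≤ -x n} => a i * r i := by
      have := (mem_domain_hardyOp.1 h2).1 n
      simp only [hu, hardyOp_testVec] at this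
      simpa only [← RCLike.ofReal_mul, RCLike.summable_ofReal] using this
    have hge : M * N ≤ ∑' i : {i : ℕ // -x i ≤ -x n}, a i * r i := by
      have hle := hsm.sum_le_tsum (({i ∈ F | x k ≤ x i} : Finset ℕ).subtype fun i => -x i ≤ -x n)
        fun i _ => mul_nonneg (ha i) (hr0 i)
      refine le_trans (le_of_eq ?_) hle
      rw [Finset.sum_subtype_eq_sum_filter (f := fun i => a i * r i), hM, Finset.sum_mul,
        Finset.filter_filter]
      refine (Finset.sum_congr (Finset.filter_congr fun j _ => by grind) fun j hj => ?_)
      rw [hrn j (by grind)]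
      ring
    rw [hval, RCLike.norm_ofReal, sq_abs]
    exact pow_le_pow_left₀ (by have := hb n; positivity)
      (mul_le_mul_of_nonneg_left hge (hb n)) 2
  have hsum := (Finset.sum_le_sum hrow).trans ((EllTwo.sum_sq_le _ _).trans
    (pow_le_pow_left₀ (norm_nonneg _) (S.le_opNorm u) 2))
  simp only [mul_pow] at hsum
  rw [hu2, ← Finset.sum_mul, ← hN] at hsum
  have hdef : muckenhoupt x a b F k = N * M := rfl
  rw [hdef]
  rcases hN0.eq_or_lt with h0 | h0
  · rw [← h0]
    simp
  · refine abs_le_of_sq_le_sq' (le_of_mul_le_mul_right ?_ h0) (norm_nonneg _) |>.2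
    exact le_trans (le_of_eq (by ring)) hsum

/-- With P the projection onto the first m coordinates, (1 - P)W(1 - P) is the Hardy operator with
both weights cut off below m. Only products with k ≥ m enter its norm bound, and the rest of W is
compact. -/
theorem Represents.isCompactOperator_hardyOp {W : EllTwo 𝕜 →L[𝕜] EllTwo 𝕜}
    (ha : ∀ i, 0 ≤ a i) (hb : ∀ i, 0 ≤ b i)
    (hsum : ∀ n, Summable fun k : {k : ℕ // x k ≤ x n} => b k ^ 2)
    (h : Represents (hardyOp 𝕜 x a b) W) (hv : MuckenhouptVanishing x a b) :
    IsCompactOperator W := by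
  refine isCompactOperator_of_forall_exists_norm_sub_le fun ε hε => ?_
  -- The finite Hardy inequality has constant 4β for the square, so β = ε²/4 gives norm at most ε.
  obtain ⟨m, hm⟩ := eventually_atTop.1 (hv (ε ^ 2 / 4) (by positivity))
  set P := coordProj 𝕜 (Finset.range m) with hP
  have hPc : IsCompactOperator P := isCompactOperator_coordProj _
  refine ⟨P ∘L W + (W - P ∘L W) ∘L P, (hPc.comp_clm W).add (hPc.clm_comp (W - P ∘L W)), ?_⟩
  set a' : ℕ → ℝ := fun n => if m ≤ n then a n else 0 with ha'
  set b' : ℕ → ℝ := fun n => if m ≤ n then b n else 0 with hb'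
  have hb'le (n) : b' n ^ 2 ≤ b n ^ 2 := by
    simp only [hb']
    split_ifs
    · rfl
    · simpa using sq_nonneg (b n)
  obtain ⟨W', hW', hnorm⟩ := exists_represents_hardyOp (𝕜 := 𝕜) (x := x) (a := a') (b := b') hε.le
    (fun i => by simp only [ha']; split_ifs <;> simp [ha])
    (fun i => by simp only [hb']; split_ifs <;> simp [hb])
    (fun n => .of_nonneg_of_le (fun _ => sq_nonneg _) (fun k => hb'le k) (hsum n))
    (fun F g => by
      have hle := hardy_inequality_finset {n ∈ F | m ≤ n} x a b g (β := ε ^ 2 / 4) (by positivity)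
        fun k hk => hm k (Finset.mem_filter.1 hk).2 _
      have heq : ∑ n ∈ F, (a' n * ∑ k ∈ F with x k ≤ x n, b' k * g k) ^ 2 =
          ∑ n ∈ F with m ≤ n, (a n * ∑ k ∈ {n ∈ F | m ≤ n} with x k ≤ x n, b k * g k) ^ 2 := by
        rw [Finset.sum_filter]
        refine Finset.sum_congr rfl fun n _ => ?_
        simp only [ha', hb']
        split_ifs
        · rw [Finset.filter_comm]
          simp only [ite_mul, zero_mul, Finset.sum_filter]
        · simp
      rw [heq]
      refine hle.trans ?_
      rw [mul_div_cancel₀ _ (by norm_num)]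
      gcongr
      exact Finset.filter_subset _ _)
  have heq : W - (P ∘L W + (W - P ∘L W) ∘L P) = W' := by
    refine ContinuousLinearMap.ext fun f => lp.ext (funext fun n => ?_)
    have h1 : (W - (P ∘L W + (W - P ∘L W) ∘L P)) f = W (f - P f) - P (W (f - P f)) := by
      simp only [sub_apply, add_apply, ContinuousLinearMap.comp_apply, map_sub]
      abel
    rw [h1, lp.coeFn_sub, Pi.sub_apply, hP, coordProj_apply, hW'.hardyOp_apply, h.hardyOp_apply]
    simp only [Finset.mem_range, ha']
    by_cases hn : n < m
    · simp [hn, not_le.2 hn]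
    · rw [if_neg hn, if_pos (not_lt.1 hn), sub_zero]
      congr 1
      refine tsum_congr fun k => ?_
      rw [lp.coeFn_sub, Pi.sub_apply, coordProj_apply]
      simp only [hb', Finset.mem_range]
      by_cases hk : (k : ℕ) < m
      · simp [hk, not_le.2 hk]
      · simp [hk, not_lt.1 hk]
  rw [heq]
  exact hnorm

theorem Represents.muckenhouptVanishing_of_hardyOp {W : EllTwo 𝕜 →L[𝕜] EllTwo 𝕜}
    (ha : ∀ i, 0 ≤ a i) (hb : ∀ i, 0 ≤ b i)
    (h : Represents (hardyOp 𝕜 x a b) W) (hc : IsCompactOperator W)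
    (hx : ∀ n, {k | x k ≤ x n}.Finite) : MuckenhouptVanishing x a b :=
  .of_isCompactOperator (κ := 1) ha hb one_pos
    (fun n j hjn => ⟨_, h.hardyOp_single j n, by simp [hjn]⟩) hc hx

/-- The order type of `ω` or its reverse, for the order on indices induced by `x`. -/
def LocallyFiniteBelowOrAbove (x : ℕ → ℝ) : Prop :=
  (∀ n, {k | x k ≤ x n}.Finite) ∨ ∀ n, {k | x n ≤ x k}.Finite

/-- Boundedness and compactness of `T` are governed by the Muckenhoupt products. -/
structure MuckenhouptCriteria (x a b : ℕ → ℝ) {E F : Type*} [NormedAddCommGroup E]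
    [NormedSpace 𝕜 E] [NormedAddCommGroup F] [NormedSpace 𝕜 F] (T : E →ₗ.[𝕜] F) : Prop where
  bounded_iff : IsBoundedOp T ↔ MuckenhouptBounded x a b
  isCompactOp : MuckenhouptBounded x a b → MuckenhouptVanishing x a b → IsCompactOp T
  vanishing : IsCompactOp T → LocallyFiniteBelowOrAbove x → MuckenhouptVanishing x a b

theorem MuckenhouptCriteria.neg {E F : Type*} [NormedAddCommGroup E]
    [NormedSpace 𝕜 E] [NormedAddCommGroup F] [NormedSpace 𝕜 F] {T : E →ₗ.[𝕜] F}
    (h : MuckenhouptCriteria (fun i => -x i) b a T) : MuckenhouptCriteria x a b T where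
  bounded_iff := h.bounded_iff.trans muckenhouptBounded_neg
  isCompactOp hb hv := h.isCompactOp (muckenhouptBounded_neg.2 hb) (muckenhouptVanishing_neg.2 hv)
  vanishing hc hx := by
    refine muckenhouptVanishing_neg.1 (h.vanishing hc ?_)
    simpa only [LocallyFiniteBelowOrAbove, neg_le_neg_iff] using hx.symm

/-- If the Muckenhoupt products are bounded, then `b²` is summable over `{k | x_k ≤ x_n}` and `a²`
over `{k | x_k ≥ x_n}` for every `n`. -/
def HasFiniteTails (x a b : ℕ → ℝ) : Prop :=
  MuckenhouptBounded x a b → (∀ n, Summable fun k : {k : ℕ // x k ≤ x n} => b k ^ 2) ∧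
    ∀ n, Summable fun k : {k : ℕ // -x k ≤ -x n} => a k ^ 2

theorem HasFiniteTails.neg (h : HasFiniteTails x a b) :
    HasFiniteTails (fun i => -x i) b a := by
  intro hb
  obtain ⟨h1, h2⟩ := h (muckenhouptBounded_neg.1 hb)
  refine ⟨h2, fun n => ?_⟩
  exact (Equiv.subtypeEquivRight fun k => by simp).summable_iff.2 (h1 n)

theorem HasFiniteTails.exists_represents (ht : HasFiniteTails x a b) (ha : ∀ i, 0 ≤ a i)
    (hb : ∀ i, 0 ≤ b i) (h : MuckenhouptBounded x a b) :
    ∃ W : EllTwo 𝕜 →L[𝕜] EllTwo 𝕜, Represents (hardyOp 𝕜 x a b) W ∧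
      Represents (hardyOp 𝕜 (fun i => -x i) b a) (ContinuousLinearMap.adjoint W) := by
  obtain ⟨W, hW⟩ := h.exists_represents (𝕜 := 𝕜) ha hb (ht h).1
  obtain ⟨W', hW'⟩ := (muckenhouptBounded_neg.2 h).exists_represents (𝕜 := 𝕜) hb ha (ht h).2
  rw [hW.hardyOp_adjoint hW'] at hW'
  exact ⟨W, hW, hW'⟩

/-- If it is the upper sets that are finite, the argument runs on the adjoint, which is the Hardy
operator for -x and is compact as well. -/
theorem Represents.muckenhouptVanishing_of_locallyFinite {W : EllTwo 𝕜 →L[𝕜] EllTwo 𝕜}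
    (ha : ∀ i, 0 ≤ a i) (hb : ∀ i, 0 ≤ b i)
    (h : Represents (hardyOp 𝕜 x a b) W)
    (h' : Represents (hardyOp 𝕜 (fun i => -x i) b a) (ContinuousLinearMap.adjoint W))
    (hc : IsCompactOperator W) (hx : LocallyFiniteBelowOrAbove x) :
    MuckenhouptVanishing x a b := by
  rcases hx with hx | hx
  · exact h.muckenhouptVanishing_of_hardyOp ha hb hc hx
  · exact muckenhouptVanishing_neg.1
      (h'.muckenhouptVanishing_of_hardyOp hb ha hc.adjoint (by simpa only [neg_le_neg_iff] using hx))

theorem muckenhouptCriteria_hardyOp (ha : ∀ i, 0 ≤ a i) (hb : ∀ i, 0 ≤ b i)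
    (ht : HasFiniteTails x a b) : MuckenhouptCriteria x a b (hardyOp 𝕜 x a b) where
  bounded_iff := by
    refine ⟨fun h => ?_, fun h => ?_⟩
    · obtain ⟨W, hW⟩ := isBoundedOp_iff_exists_represents.1 h
      exact hW.muckenhouptBounded_of_hardyOp ha hb
    · obtain ⟨W, hW, -⟩ := ht.exists_represents (𝕜 := 𝕜) ha hb h
      exact hW.isBoundedOp
  isCompactOp h hv := by
    obtain ⟨W, hW, -⟩ := ht.exists_represents (𝕜 := 𝕜) ha hb h
    exact hW.isCompactOp_iff.2 (hW.isCompactOperator_hardyOp ha hb (ht h).1 hv)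
  vanishing hc hx := by
    obtain ⟨W, hW⟩ := isBoundedOp_iff_exists_represents.1 hc.isBoundedOp
    obtain ⟨W', hW', hadj⟩ := ht.exists_represents (𝕜 := 𝕜) ha hb
      (hW.muckenhouptBounded_of_hardyOp ha hb)
    exact hW'.muckenhouptVanishing_of_locallyFinite ha hb hadj (hW'.isCompactOp_iff.1 hc) hx

theorem muckenhouptCriteria_hardyOp_comp (ha : ∀ i, 0 ≤ a i) (hb : ∀ i, 0 ≤ b i)
    (ht : HasFiniteTails x a b) :
    MuckenhouptCriteria x a b
      (compOp (hardyOp 𝕜 (fun i => -x i) b a) (hardyOp 𝕜 x a b)) where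
  bounded_iff := by
    refine ⟨fun h => ?_, fun h => ?_⟩
    · obtain ⟨W, hW⟩ := isBoundedOp_iff_exists_represents.1 h
      exact hW.muckenhouptBounded_of_comp ha hb
    · obtain ⟨W, hW, hadj⟩ := ht.exists_represents (𝕜 := 𝕜) ha hb h
      exact (hadj.compOp hW).isBoundedOp
  isCompactOp h hv := by
    obtain ⟨W, hW, hadj⟩ := ht.exists_represents (𝕜 := 𝕜) ha hb h
    exact (hadj.compOp hW).isCompactOp_iff.2 (isCompactOperator_adjoint_comp_self_iff.2
      (hW.isCompactOperator_hardyOp ha hb (ht h).1 hv))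
  vanishing hc hx := by
    obtain ⟨W, hW⟩ := isBoundedOp_iff_exists_represents.1 hc.isBoundedOp
    obtain ⟨W', hW', hadj⟩ := ht.exists_represents (𝕜 := 𝕜) ha hb
      (hW.muckenhouptBounded_of_comp ha hb)
    exact hW'.muckenhouptVanishing_of_locallyFinite ha hb hadj
      (isCompactOperator_adjoint_comp_self_iff.1 ((hadj.compOp hW').isCompactOp_iff.1 hc)) hx

end Hardy

/-! ### Finiteness of N and M at every point. -/

section FiniteTails

theorem summable_subtype_of_sum_filter_le {p : ℕ → Prop} [DecidablePred p] {f : ℕ → ℝ}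
    (hf : ∀ k, 0 ≤ f k) {c : ℝ} (h : ∀ F : Finset ℕ, ∑ k ∈ F with p k, f k ≤ c) :
    Summable fun k : {k // p k} => f k := by
  refine (summable_subtype_iff_indicator (s := {k | p k}) (f := f)).2
    (summable_of_sum_le (c := c) (fun k => Set.indicator_nonneg (fun k _ => hf k) k) fun F => ?_)
  refine le_trans (le_of_eq ?_) (h F)
  rw [Finset.sum_filter]
  refine Finset.sum_congr rfl fun k _ => ?_
  by_cases hp : p k <;> simp [Set.indicator, hp]

/-- A bounded product could hide an infinite factor behind a zero one. At a k with d_k ≠ 0 both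
factors are positive, hence both are bounded; other points are reached by comparing d_j² with
(d_j/x_j)². -/
theorem hasFiniteTails {x d : ℕ → ℝ} (hx : ∀ i, 0 < x i) :
    HasFiniteTails x (fun n => d n / x n) d := by
  rintro ⟨β, hβ⟩
  by_cases h0 : ∀ k, d k = 0
  · simp [h0, summable_zero]
  push Not at h0
  obtain ⟨k, hk⟩ := h0
  have hdk : 0 < d k ^ 2 := by positivity
  have hdxk : 0 < (d k / x k) ^ 2 := by have := hx k; positivity
  have hlow (F : Finset ℕ) : ∑ j ∈ F with x j ≤ x k, d j ^ 2 ≤ β / (d k / x k) ^ 2 := by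
    rw [le_div_iff₀ hdxk]
    refine le_trans (mul_le_mul ?_ ?_ hdxk.le ?_) (hβ (insert k F) k)
    · exact Finset.sum_le_sum_of_subset_of_nonneg
        (Finset.filter_subset_filter _ (Finset.subset_insert _ _)) fun _ _ _ => sq_nonneg _
    · exact Finset.single_le_sum (f := fun j => (d j / x j) ^ 2) (fun _ _ => sq_nonneg _)
        (by simp)
    · exact Finset.sum_nonneg fun _ _ => sq_nonneg _
  have hhigh (F : Finset ℕ) : ∑ j ∈ F with x k ≤ x j, (d j / x j) ^ 2 ≤ β / d k ^ 2 := by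
    rw [le_div_iff₀ hdk, mul_comm]
    refine le_trans (mul_le_mul ?_ ?_ ?_ ?_) (hβ (insert k F) k)
    · exact Finset.single_le_sum (f := fun j => d j ^ 2) (fun _ _ => sq_nonneg _) (by simp)
    · exact Finset.sum_le_sum_of_subset_of_nonneg
        (Finset.filter_subset_filter _ (Finset.subset_insert _ _)) fun _ _ _ => sq_nonneg _
    all_goals exact Finset.sum_nonneg fun _ _ => sq_nonneg _
  constructor
  · intro n
    -- Indices with x_j ≤ x_k are covered by the first term of the constant. The others with x_j ≤
    -- x_n satisfy d_j² ≤ x_n² (d_j/x_j)² and are covered by the second.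
    refine summable_subtype_of_sum_filter_le (fun _ => sq_nonneg _)
      (c := β / (d k / x k) ^ 2 + x n ^ 2 * (β / d k ^ 2)) fun F => ?_
    refine le_trans ?_ (add_le_add (hlow F) (mul_le_mul_of_nonneg_left (hhigh F) (sq_nonneg _)))
    rw [Finset.mul_sum, Finset.sum_filter, Finset.sum_filter, Finset.sum_filter,
      ← Finset.sum_add_distrib]
    refine Finset.sum_le_sum fun j _ => ?_
    have hj := hx j
    have h1 : 0 ≤ x n ^ 2 * (d j / x j) ^ 2 := by positivity
    have h2 : x j ≤ x n → d j ^ 2 ≤ x n ^ 2 * (d j / x j) ^ 2 := by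
      intro h
      calc d j ^ 2 = x j ^ 2 * (d j / x j) ^ 2 := by field_simp
        _ ≤ _ := by gcongr
    rcases le_total (x j) (x k) with h3 | h3
    · rw [if_pos h3]
      split_ifs <;> linarith [sq_nonneg (d j)]
    · rw [if_pos h3]
      by_cases h4 : x j ≤ x n
      · rw [if_pos h4]
        split_ifs <;> linarith [sq_nonneg (d j), h2 h4]
      · rw [if_neg h4]
        split_ifs <;> linarith [sq_nonneg (d j)]
  · intro n
    refine summable_subtype_of_sum_filter_le (p := fun k => -x k ≤ -x n)
      (f := fun k => (d k / x k) ^ 2) (fun _ => sq_nonneg _)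
      (c := β / d k ^ 2 + (x n ^ 2)⁻¹ * (β / (d k / x k) ^ 2)) fun F => ?_
    refine le_trans ?_ (add_le_add (hhigh F) (mul_le_mul_of_nonneg_left (hlow F) (by positivity)))
    rw [Finset.mul_sum, Finset.sum_filter, Finset.sum_filter, Finset.sum_filter,
      ← Finset.sum_add_distrib]
    refine Finset.sum_le_sum fun j _ => ?_
    have hj := hx j
    have hn := hx n
    have h0 : 0 ≤ (d j / x j) ^ 2 := sq_nonneg _
    have h1 : 0 ≤ (x n ^ 2)⁻¹ * d j ^ 2 := by positivity
    have h2 : x n ≤ x j → (d j / x j) ^ 2 ≤ (x n ^ 2)⁻¹ * d j ^ 2 := by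
      intro h
      calc (d j / x j) ^ 2 = (x j ^ 2)⁻¹ * d j ^ 2 := by ring
        _ ≤ _ := by gcongr
    simp only [neg_le_neg_iff]
    rcases le_total (x j) (x k) with h3 | h3
    · rw [if_pos h3]
      by_cases h4 : x n ≤ x j
      · rw [if_pos h4]
        split_ifs <;> linarith [h2 h4]
      · rw [if_neg h4]
        split_ifs <;> linarith
    · rw [if_pos h3]
      split_ifs <;> linarith

end FiniteTails

/-! ### Sampling and synthesis operators with Cauchy Gram matrix. -/

section Cauchy

variable {𝕜 : Type*} [RCLike 𝕜] {μ : Measure ℝ} {φ : ℕ → ℝ → ℝ} {x d : ℕ → ℝ}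

theorem half_mul_div_le (hx : ∀ i, 0 < x i) (hd : ∀ i, 0 ≤ d i) {n j : ℕ} (h : x j ≤ x n) :
    1 / 2 * (d n / x n * d j) ≤ d n * d j / (x n + x j) := by
  have hn := hx n
  have hj := hx j
  have h0 := mul_nonneg (hd n) (hd j)
  calc 1 / 2 * (d n / x n * d j) = d n * d j / (x n + x n) := by field_simp; ring
    _ ≤ _ := by gcongr

/-- The functions `φ_n` have the Cauchy matrix `1 / (x_n + x_k)` as their Gram matrix in `L²(μ)`,
and satisfy pointwise `φ_n(t) = O(min(1, 1 / x_n))`. -/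
structure HasCauchyGram (μ : Measure ℝ) (φ : ℕ → ℝ → ℝ) (x : ℕ → ℝ) : Prop where
  memLp : ∀ n, MemLp (φ n) 2 μ
  gram : ∀ n k, ∫ t, φ n t * φ k t ∂μ = 1 / (x n + x k)
  pointwise : ∀ᵐ t ∂μ, ∃ C, ∀ n, φ n t ^ 2 ≤ C ∧ x n ^ 2 * φ n t ^ 2 ≤ C

namespace HasCauchyGram

/-- `φ_n` as an element of `L²(μ)` over `𝕜`. -/
def vec (𝕜 : Type*) [RCLike 𝕜] (hφ : HasCauchyGram μ φ x) (n : ℕ) : Lp 𝕜 2 μ :=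
  ((hφ.memLp n).ofReal (K := 𝕜)).toLp

theorem coeFn_vec (hφ : HasCauchyGram μ φ x) (n : ℕ) : hφ.vec 𝕜 n =ᵐ[μ] fun t => (φ n t : 𝕜) :=
  MemLp.coeFn_toLp _

theorem integrable_mul (hφ : HasCauchyGram μ φ x) (f : Lp 𝕜 2 μ) (n : ℕ) : Integrable (fun t => f t * (φ n t : 𝕜)) μ := by
  refine (L2.integrable_inner (𝕜 := 𝕜) (hφ.vec 𝕜 n) f).congr ?_
  filter_upwards [hφ.coeFn_vec (𝕜 := 𝕜) n] with t ht
  rw [ht, RCLike.inner_apply, RCLike.conj_ofReal]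

theorem inner_vec (hφ : HasCauchyGram μ φ x) (f : Lp 𝕜 2 μ) (n : ℕ) :
    inner 𝕜 (hφ.vec 𝕜 n) f = ∫ t, f t * (φ n t : 𝕜) ∂μ := by
  rw [L2.inner_def]
  refine integral_congr_ae ?_
  filter_upwards [hφ.coeFn_vec (𝕜 := 𝕜) n] with t ht
  rw [ht, RCLike.inner_apply, RCLike.conj_ofReal]

theorem inner_vec_vec (hφ : HasCauchyGram μ φ x) (n k : ℕ) :
    inner 𝕜 (hφ.vec 𝕜 n) (hφ.vec 𝕜 k) = ((1 / (x n + x k) : ℝ) : 𝕜) := by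
  rw [hφ.inner_vec, ← hφ.gram, ← integral_ofReal]
  refine integral_congr_ae ?_
  filter_upwards [hφ.coeFn_vec (𝕜 := 𝕜) k] with t ht
  rw [ht]
  push_cast
  ring

theorem samplingOp_apply (hφ : HasCauchyGram μ φ x) {f : Lp 𝕜 2 μ} (h : f ∈ (samplingOp 𝕜 μ φ d).domain) (n : ℕ) :
    samplingOp 𝕜 μ φ d ⟨f, h⟩ n = (d n : 𝕜) * inner 𝕜 (hφ.vec 𝕜 n) f := by
  rw [hφ.inner_vec]
  rfl

theorem represents_samplingOp_apply (hφ : HasCauchyGram μ φ x) {V : Lp 𝕜 2 μ →L[𝕜] EllTwo 𝕜}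
    (h : Represents (samplingOp 𝕜 μ φ d) V) (f : Lp 𝕜 2 μ) (n : ℕ) :
    V f n = (d n : 𝕜) * inner 𝕜 (hφ.vec 𝕜 n) f := by
  rw [← (h f).2, hφ.samplingOp_apply]

theorem norm_sum_smul_vec_sq_le (hφ : HasCauchyGram μ φ x) (hx : ∀ i, 0 < x i) (hd : ∀ i, 0 ≤ d i) (F : Finset ℕ) {β : ℝ}
    (hβ : 0 ≤ β) (h : ∀ k ∈ F, muckenhoupt x (fun n => d n / x n) d F k ≤ β) (g : ℕ → 𝕜) :
    ‖∑ n ∈ F, (g n * d n) • hφ.vec 𝕜 n‖ ^ 2 ≤ 4 * √β * ∑ n ∈ F, ‖g n‖ ^ 2 := by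
  refine le_trans ?_ (sum_sum_div_add_le F x d (fun n => ‖g n‖) hx hd (fun _ => norm_nonneg _) hβ h)
  rw [norm_sq_eq_re_inner (𝕜 := 𝕜), sum_inner]
  simp only [inner_sum, inner_smul_left, inner_smul_right, hφ.inner_vec_vec]
  refine (RCLike.re_le_norm _).trans (norm_sum_le_of_le _ fun n _ => norm_sum_le_of_le _ fun k _ => ?_)
  have hn := hx n
  have hk := hx k
  simp only [norm_mul, RCLike.norm_conj, RCLike.norm_of_nonneg (hd _)]
  rw [RCLike.norm_of_nonneg (by positivity)]
  exact le_of_eq (by ring)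

/-- Duality with the synthesis bound: taking the samples themselves as coefficients g, their square
sum s equals ⟨∑ g_n d_n φ_n, f⟩, so s² ≤ 4√β s ‖f‖². -/
theorem sum_sq_inner_vec_le (hφ : HasCauchyGram μ φ x) (hx : ∀ i, 0 < x i) (hd : ∀ i, 0 ≤ d i) (F : Finset ℕ) {β : ℝ}
    (hβ : 0 ≤ β) (h : ∀ k ∈ F, muckenhoupt x (fun n => d n / x n) d F k ≤ β) (f : Lp 𝕜 2 μ) :
    ∑ n ∈ F, ‖(d n : 𝕜) * inner 𝕜 (hφ.vec 𝕜 n) f‖ ^ 2 ≤ 4 * √β * ‖f‖ ^ 2 := by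
  set g : ℕ → 𝕜 := fun n => (d n : 𝕜) * inner 𝕜 (hφ.vec 𝕜 n) f with hg
  set s := ∑ n ∈ F, ‖g n‖ ^ 2 with hs
  have hs0 : 0 ≤ s := Finset.sum_nonneg fun _ _ => sq_nonneg _
  have h1 := hφ.norm_sum_smul_vec_sq_le hx hd F hβ h g
  have h2 : inner 𝕜 (∑ n ∈ F, (g n * d n) • hφ.vec 𝕜 n) f = (s : 𝕜) := by
    rw [sum_inner, hs]
    push_cast
    refine Finset.sum_congr rfl fun n _ => ?_
    rw [inner_smul_left, ← RCLike.conj_mul, map_mul, RCLike.conj_ofReal, mul_assoc]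
  have h3 : s ≤ ‖∑ n ∈ F, (g n * d n) • hφ.vec 𝕜 n‖ * ‖f‖ := by
    have := norm_inner_le_norm (𝕜 := 𝕜) (∑ n ∈ F, (g n * d n) • hφ.vec 𝕜 n) f
    rwa [h2, RCLike.norm_of_nonneg hs0] at this
  rcases hs0.eq_or_lt with h4 | h4
  · rw [← h4]; positivity
  refine le_of_mul_le_mul_left ?_ h4
  calc s * s = s ^ 2 := (sq s).symm
    _ ≤ (‖∑ n ∈ F, (g n * d n) • hφ.vec 𝕜 n‖ * ‖f‖) ^ 2 := pow_le_pow_left₀ hs0 h3 2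
    _ = ‖∑ n ∈ F, (g n * d n) • hφ.vec 𝕜 n‖ ^ 2 * ‖f‖ ^ 2 := mul_pow _ _ _
    _ ≤ 4 * √β * s * ‖f‖ ^ 2 := by gcongr
    _ = _ := by ring

theorem exists_represents_samplingOp (hφ : HasCauchyGram μ φ x) (hx : ∀ i, 0 < x i) (hd : ∀ i, 0 ≤ d i)
    (h : MuckenhouptBounded x (fun n => d n / x n) d) :
    ∃ V : Lp 𝕜 2 μ →L[𝕜] EllTwo 𝕜, Represents (samplingOp 𝕜 μ φ d) V := by
  obtain ⟨β, hβ⟩ := h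
  have hβ0 : 0 ≤ β := (muckenhoupt_nonneg x _ d ∅ 0).trans (hβ ∅ 0)
  have hbound (f : Lp 𝕜 2 μ) (F : Finset ℕ) :
      ∑ n ∈ F, ‖(d n : 𝕜) * ∫ t, f t * (φ n t : 𝕜) ∂μ‖ ^ 2 ≤ 4 * √β * ‖f‖ ^ 2 := by
    simpa only [hφ.inner_vec] using hφ.sum_sq_inner_vec_le hx hd F hβ0 (fun k _ => hβ F k) f
  have hmem (f : Lp 𝕜 2 μ) : f ∈ (samplingOp 𝕜 μ φ d).domain :=
    ⟨hφ.integrable_mul f, EllTwo.memℓp_of_forall_sum_sq_le (hbound f)⟩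
  refine isBoundedOp_iff_exists_represents.1
    ⟨(Submodule.eq_top_iff').2 hmem, √(4 * √β), fun f => ?_⟩
  refine EllTwo.norm_le_of_forall_sum_sq_le (by positivity) fun F => ?_
  rw [mul_pow, Real.sq_sqrt (by positivity)]
  exact hbound f F

/-- By the closed graph theorem, the sampling operator is bounded if it is everywhere defined. -/
theorem exists_represents_of_domain_eq_top (hφ : HasCauchyGram μ φ x) (h : (samplingOp 𝕜 μ φ d).domain = ⊤) :
    ∃ V : Lp 𝕜 2 μ →L[𝕜] EllTwo 𝕜, Represents (samplingOp 𝕜 μ φ d) V := by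
  have hmem (f : Lp 𝕜 2 μ) : f ∈ (samplingOp 𝕜 μ φ d).domain := by rw [h]; trivial
  set T : Lp 𝕜 2 μ →ₗ[𝕜] EllTwo 𝕜 := (samplingOp 𝕜 μ φ d).toFun ∘ₗ
    (LinearMap.id : Lp 𝕜 2 μ →ₗ[𝕜] Lp 𝕜 2 μ).codRestrict _ hmem with hT
  have hTn (f : Lp 𝕜 2 μ) (n : ℕ) : T f n = (d n : 𝕜) * inner 𝕜 (hφ.vec 𝕜 n) f :=
    hφ.samplingOp_apply (hmem f) n
  have hcont : Continuous T := by
    -- The graph is closed because each coordinate of T is an inner product with a fixed vector.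
    refine T.continuous_of_seq_closed_graph fun u f y hu hTu => lp.ext (funext fun n => ?_)
    have h1 : Tendsto (fun i => T (u i) n) atTop (𝓝 (y n)) :=
      ((lp.evalCLM 𝕜 (fun _ : ℕ => 𝕜) 2 n).continuous.tendsto y).comp hTu
    have h2 : Tendsto (fun i => T (u i) n) atTop (𝓝 (T f n)) := by
      simp only [hTn]
      exact tendsto_const_nhds.mul (tendsto_const_nhds.inner hu)
    exact tendsto_nhds_unique h1 h2
  exact ⟨⟨T, hcont⟩, fun f => ⟨hmem f, rfl⟩⟩

theorem adjoint_single (hφ : HasCauchyGram μ φ x) {V : Lp 𝕜 2 μ →L[𝕜] EllTwo 𝕜}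
    (h : Represents (samplingOp 𝕜 μ φ d) V) (j : ℕ) (c : 𝕜) :
    ContinuousLinearMap.adjoint V (lp.single 2 j c) = (d j * c) • hφ.vec 𝕜 j := by
  refine ext_inner_left 𝕜 fun f => ?_
  rw [ContinuousLinearMap.adjoint_inner_right, lp.inner_single_right,
    hφ.represents_samplingOp_apply h, inner_smul_right, RCLike.inner_apply, map_mul,
    RCLike.conj_ofReal, inner_conj_symm]
  ring

/-- The sequence d_i φ_i(t) is square summable for almost every t: below the arbitrary split point
x_0 use φ_i² ≤ C and ∑ d_i² < ∞, above it x_i² φ_i² ≤ C and ∑ (d_i/x_i)² < ∞. Pairing with f ∈ ℓ²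
then converges absolutely. -/
theorem ae_summable (hφ : HasCauchyGram μ φ x) (hx : ∀ i, 0 < x i) (h : MuckenhouptBounded x (fun n => d n / x n) d)
    (f : EllTwo 𝕜) : ∀ᵐ t ∂μ, Summable fun i => (d i : 𝕜) * f i * (φ i t : 𝕜) := by
  obtain ⟨h1, h2⟩ := hasFiniteTails hx h
  replace h1 := (summable_subtype_iff_indicator (s := {k | x k ≤ x 0})
    (f := fun k => d k ^ 2)).1 (h1 0)
  replace h2 := (summable_subtype_iff_indicator (s := {k | -x k ≤ -x 0})
    (f := fun k => (d k / x k) ^ 2)).1 (h2 0)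
  have hf : Summable fun k => ‖f k‖ ^ 2 := by
    simpa using (lp.memℓp f).summable (p := 2) (by simp)
  filter_upwards [hφ.pointwise] with t ht
  obtain ⟨C, hC⟩ := ht
  have hC0 : 0 ≤ C := (sq_nonneg _).trans (hC 0).1
  refine .of_norm_bounded (((h1.add h2).mul_left C).add hf) fun i => ?_
  have hi := hx i
  have h3 : (d i * φ i t) ^ 2 ≤ C * (Set.indicator {k | x k ≤ x 0} (fun k => d k ^ 2) i +
      Set.indicator {k | -x k ≤ -x 0} (fun k => (d k / x k) ^ 2) i) := by
    rcases le_total (x i) (x 0) with hle | hle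
    · have h4 : (0 : ℝ) ≤ Set.indicator {k | -x k ≤ -x 0} (fun k => (d k / x k) ^ 2) i :=
        Set.indicator_nonneg (fun _ _ => sq_nonneg _) _
      rw [Set.indicator_of_mem (show i ∈ {k | x k ≤ x 0} from hle)]
      calc (d i * φ i t) ^ 2 = φ i t ^ 2 * d i ^ 2 := by ring
        _ ≤ C * d i ^ 2 := mul_le_mul_of_nonneg_right (hC i).1 (sq_nonneg _)
        _ ≤ _ := by gcongr; linarith
    · have h4 : (0 : ℝ) ≤ Set.indicator {k | x k ≤ x 0} (fun k => d k ^ 2) i :=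
        Set.indicator_nonneg (fun _ _ => sq_nonneg _) _
      rw [Set.indicator_of_mem (show i ∈ {k | -x k ≤ -x 0} from neg_le_neg hle)]
      calc (d i * φ i t) ^ 2 = (x i ^ 2 * φ i t ^ 2) * (d i / x i) ^ 2 := by field_simp
        _ ≤ C * (d i / x i) ^ 2 := mul_le_mul_of_nonneg_right (hC i).2 (sq_nonneg _)
        _ ≤ _ := by gcongr; linarith
  have h5 : ‖(d i : 𝕜) * f i * (φ i t : 𝕜)‖ = |d i * φ i t| * ‖f i‖ := by
    rw [norm_mul, norm_mul, RCLike.norm_ofReal, RCLike.norm_ofReal, abs_mul]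
    ring
  rw [h5]
  rw [← sq_abs] at h3
  nlinarith [sq_nonneg (|d i * φ i t| - ‖f i‖), sq_nonneg (|d i * φ i t|), sq_nonneg ‖f i‖]

/-- The partial sums converge to V*f in L², hence almost everywhere along a subsequence; the
pointwise series converges too, so the limits agree. -/
theorem represents_synthesisOp (hφ : HasCauchyGram μ φ x) (hx : ∀ i, 0 < x i)
    (hb : MuckenhouptBounded x (fun n => d n / x n) d) {V : Lp 𝕜 2 μ →L[𝕜] EllTwo 𝕜}
    (h : Represents (samplingOp 𝕜 μ φ d) V) :
    Represents (synthesisOp 𝕜 μ φ d) (ContinuousLinearMap.adjoint V) := by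
  intro f
  have hsum := hφ.ae_summable hx hb f
  have hlim : Tendsto (fun N => ∑ i ∈ Finset.range N, (d i * f i) • hφ.vec 𝕜 i) atTop
      (𝓝 (ContinuousLinearMap.adjoint V f)) := by
    have := ((lp.hasSum_single (p := 2) (by simp) f).mapL
      (ContinuousLinearMap.adjoint V)).tendsto_sum_nat
    simpa only [hφ.adjoint_single h] using this
  obtain ⟨ns, hns, hae⟩ := (tendstoInMeasure_of_tendsto_Lp hlim).exists_seq_tendsto_ae
  have hvec : ∀ᵐ t ∂μ, ∀ i, hφ.vec 𝕜 i t = (φ i t : 𝕜) := ae_all_iff.2 fun i => hφ.coeFn_vec i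
  have hpartial : ∀ᵐ t ∂μ, ∀ N, (∑ i ∈ Finset.range N, (d i * f i) • hφ.vec 𝕜 i : Lp 𝕜 2 μ) t =
      ∑ i ∈ Finset.range N, (d i : 𝕜) * f i * (φ i t : 𝕜) := by
    refine ae_all_iff.2 fun N => ?_
    have hsm : ∀ᵐ t ∂μ, ∀ i, ((d i * f i) • hφ.vec 𝕜 i : Lp 𝕜 2 μ) t =
        (d i * f i) * hφ.vec 𝕜 i t := ae_all_iff.2 fun i => Lp.coeFn_smul _ _
    filter_upwards [Lp.coeFn_finsetSum (Finset.range N) (fun i => (d i * f i) • hφ.vec 𝕜 i),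
      hvec, hsm] with t h1 h2 h3
    rw [h1, Finset.sum_apply]
    exact Finset.sum_congr rfl fun i _ => by rw [h3, h2]
  have heq : ContinuousLinearMap.adjoint V f =ᵐ[μ]
      fun t => ∑' i, (d i : 𝕜) * f i * (φ i t : 𝕜) := by
    filter_upwards [hsum, hae, hpartial] with t h1 h2 h3
    refine tendsto_nhds_unique h2 ?_
    simp only [h3]
    exact h1.hasSum.tendsto_sum_nat.comp hns.tendsto_atTop
  have hmem : f ∈ (synthesisOp 𝕜 μ φ d).domain := ⟨hsum, (memLp_congr_ae heq).1 (Lp.memLp _)⟩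
  refine ⟨hmem, Lp.ext ?_⟩
  exact (MemLp.coeFn_toLp hmem.2).trans heq.symm

theorem synthesisOp_single (hφ : HasCauchyGram μ φ x) {Y : EllTwo 𝕜 →L[𝕜] Lp 𝕜 2 μ}
    (h : Represents (synthesisOp 𝕜 μ φ d) Y) (j : ℕ) :
    Y (lp.single 2 j 1) = (d j : 𝕜) • hφ.vec 𝕜 j := by
  obtain ⟨hmem, hY⟩ := h (lp.single 2 j 1)
  rw [← hY]
  refine Lp.ext ((MemLp.coeFn_toLp hmem.2).trans ?_)
  filter_upwards [Lp.coeFn_smul (d j : 𝕜) (hφ.vec 𝕜 j), hφ.coeFn_vec (𝕜 := 𝕜) j] with t h1 h2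
  rw [h1, Pi.smul_apply, h2, tsum_eq_single j, lp.single_apply_self]
  · simp
  · intro i hi
    rw [lp.single_apply_ne _ _ _ hi]
    simp

theorem entries_of_single (hφ : HasCauchyGram μ φ x) {H : EllTwo 𝕜 →L[𝕜] EllTwo 𝕜} {Y : EllTwo 𝕜 →L[𝕜] Lp 𝕜 2 μ}
    (hY : ∀ j, Y (lp.single 2 j 1) = (d j : 𝕜) • hφ.vec 𝕜 j)
    (hH : H = ContinuousLinearMap.adjoint Y ∘L Y) (n j : ℕ) :
    H (lp.single 2 j 1) n = ((d n * d j / (x n + x j) : ℝ) : 𝕜) := by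
  rw [← EllTwo.inner_single_one (H _), hH, ContinuousLinearMap.comp_apply,
    ContinuousLinearMap.adjoint_inner_right, hY, hY, inner_smul_left, inner_smul_right,
    hφ.inner_vec_vec, RCLike.conj_ofReal]
  push_cast
  ring

/-- Y*Y has entries d_n d_j/(x_n + x_j), at least half the Hardy entries; the constant 4 undoes κ² =
1/4. This serves both the synthesis operator and the adjoint of the sampling operator. -/
theorem muckenhouptBounded_of_single (hφ : HasCauchyGram μ φ x) (hx : ∀ i, 0 < x i) (hd : ∀ i, 0 ≤ d i)
    {Y : EllTwo 𝕜 →L[𝕜] Lp 𝕜 2 μ}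
    (hY : ∀ j, Y (lp.single 2 j 1) = (d j : 𝕜) • hφ.vec 𝕜 j) :
    MuckenhouptBounded x (fun n => d n / x n) d := by
  refine ⟨4 * ‖ContinuousLinearMap.adjoint Y ∘L Y‖ ^ 2, fun F k => ?_⟩
  have := muckenhoupt_le_opNorm_sq (T := ContinuousLinearMap.adjoint Y ∘L Y) (κ := 1 / 2)
    (a := fun n => d n / x n) (b := d) (fun i => div_nonneg (hd i) (hx i).le) hd (by norm_num)
    (fun n j hjn => ⟨_, hφ.entries_of_single hY rfl n j, half_mul_div_le hx hd hjn⟩) F k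
  linarith

end HasCauchyGram

end Cauchy

/-! ### Criteria for sampling and synthesis, and the two concrete systems. -/

section CauchyCriteria

variable {𝕜 : Type*} [RCLike 𝕜] {μ : Measure ℝ} {φ : ℕ → ℝ → ℝ} {x d : ℕ → ℝ}

namespace HasCauchyGram

theorem isCompactOperator_of_vanishing (hφ : HasCauchyGram μ φ x) (hx : ∀ i, 0 < x i)
    (hd : ∀ i, 0 ≤ d i) {V : Lp 𝕜 2 μ →L[𝕜] EllTwo 𝕜}
    (h : Represents (samplingOp 𝕜 μ φ d) V)
    (hv : MuckenhouptVanishing x (fun n => d n / x n) d) : IsCompactOperator V := by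
  refine isCompactOperator_of_forall_exists_norm_sub_le fun ε hε => ?_
  -- Here the squared bound is 4√β, so β = (ε²/4)² makes it ε². Cutting off rows alone suffices.
  obtain ⟨m, hm⟩ := eventually_atTop.1 (hv ((ε ^ 2 / 4) ^ 2) (by positivity))
  set P := coordProj 𝕜 (Finset.range m) with hP
  refine ⟨P ∘L V, (isCompactOperator_coordProj (𝕜 := 𝕜) _).comp_clm V,
    ContinuousLinearMap.opNorm_le_bound _ hε.le fun f => ?_⟩
  refine EllTwo.norm_le_of_forall_sum_sq_le (by positivity) fun F => ?_
  have hle := hφ.sum_sq_inner_vec_le hx hd {n ∈ F | m ≤ n} (β := (ε ^ 2 / 4) ^ 2) (by positivity)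
    (fun k hk => hm k (Finset.mem_filter.1 hk).2 _) f
  rw [Real.sqrt_sq (by positivity), mul_div_cancel₀ _ (by norm_num), ← mul_pow] at hle
  refine le_trans (le_of_eq ?_) hle
  rw [Finset.sum_filter]
  refine Finset.sum_congr rfl fun n _ => ?_
  rw [sub_apply, ContinuousLinearMap.comp_apply, lp.coeFn_sub, Pi.sub_apply, hP, coordProj_apply,
    hφ.represents_samplingOp_apply h]
  by_cases hn : n < m
  · simp [hn, not_le.2 hn]
  · simp [hn, not_lt.1 hn]

/-- VV* acts on ℓ² with a symmetric Cauchy matrix, which dominates half the Hardy matrix in either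
order. -/
theorem vanishing_of_isCompactOperator (hφ : HasCauchyGram μ φ x) (hx : ∀ i, 0 < x i)
    (hd : ∀ i, 0 ≤ d i) {V : Lp 𝕜 2 μ →L[𝕜] EllTwo 𝕜}
    (h : Represents (samplingOp 𝕜 μ φ d) V) (hc : IsCompactOperator V)
    (hlf : LocallyFiniteBelowOrAbove x) : MuckenhouptVanishing x (fun n => d n / x n) d := by
  have ha (i) : 0 ≤ d i / x i := div_nonneg (hd i) (hx i).le
  have hH : IsCompactOperator (V ∘L ContinuousLinearMap.adjoint V) := hc.comp_clm _
  have hent := hφ.entries_of_single (H := V ∘L ContinuousLinearMap.adjoint V)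
    (Y := ContinuousLinearMap.adjoint V) (d := d)
    (fun j => by rw [hφ.adjoint_single h, mul_one]) (by rw [ContinuousLinearMap.adjoint_adjoint])
  rcases hlf with hlf | hlf
  · exact .of_isCompactOperator (κ := 1 / 2) ha hd (by norm_num)
      (fun n j hjn => ⟨_, hent n j, half_mul_div_le hx hd hjn⟩) hH hlf
  · refine muckenhouptVanishing_neg.1 (.of_isCompactOperator (κ := 1 / 2) hd ha (by norm_num)
      (fun n j hjn => ⟨_, hent n j, ?_⟩) hH (by simpa only [neg_le_neg_iff] using hlf))
    have := half_mul_div_le hx hd (neg_le_neg_iff.1 hjn)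
    rwa [mul_comm (d n) (d j), add_comm, mul_comm (d n)]

theorem criteria_samplingOp (hφ : HasCauchyGram μ φ x) (hx : ∀ i, 0 < x i) (hd : ∀ i, 0 ≤ d i) :
    MuckenhouptCriteria x (fun n => d n / x n) d (samplingOp 𝕜 μ φ d) where
  bounded_iff := by
    refine ⟨fun h => ?_, fun h => ?_⟩
    · obtain ⟨V, hV⟩ := isBoundedOp_iff_exists_represents.1 h
      exact hφ.muckenhouptBounded_of_single hx hd
        (fun j => by rw [hφ.adjoint_single hV, mul_one])
    · obtain ⟨V, hV⟩ := hφ.exists_represents_samplingOp (𝕜 := 𝕜) hx hd h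
      exact hV.isBoundedOp
  isCompactOp h hv := by
    obtain ⟨V, hV⟩ := hφ.exists_represents_samplingOp (𝕜 := 𝕜) hx hd h
    exact hV.isCompactOp_iff.2 (hφ.isCompactOperator_of_vanishing hx hd hV hv)
  vanishing hc hlf := by
    obtain ⟨V, hV⟩ := isBoundedOp_iff_exists_represents.1 hc.isBoundedOp
    exact hφ.vanishing_of_isCompactOperator hx hd hV (hV.isCompactOp_iff.1 hc) hlf

theorem criteria_synthesisOp (hφ : HasCauchyGram μ φ x) (hx : ∀ i, 0 < x i) (hd : ∀ i, 0 ≤ d i) :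
    MuckenhouptCriteria x (fun n => d n / x n) d (synthesisOp 𝕜 μ φ d) := by
  have hbdd (h : IsBoundedOp (synthesisOp 𝕜 μ φ d)) :
      MuckenhouptBounded x (fun n => d n / x n) d := by
    obtain ⟨Y, hY⟩ := isBoundedOp_iff_exists_represents.1 h
    exact hφ.muckenhouptBounded_of_single hx hd (hφ.synthesisOp_single hY)
  refine ⟨⟨hbdd, fun h => ?_⟩, fun h hv => ?_, fun hc hlf => ?_⟩
  · obtain ⟨V, hV⟩ := hφ.exists_represents_samplingOp (𝕜 := 𝕜) hx hd h
    exact (hφ.represents_synthesisOp hx h hV).isBoundedOp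
  · obtain ⟨V, hV⟩ := hφ.exists_represents_samplingOp (𝕜 := 𝕜) hx hd h
    exact (hφ.represents_synthesisOp hx h hV).isCompactOp_iff.2
      (hφ.isCompactOperator_of_vanishing hx hd hV hv).adjoint
  · have h := hbdd hc.isBoundedOp
    obtain ⟨V, hV⟩ := hφ.exists_represents_samplingOp (𝕜 := 𝕜) hx hd h
    exact hφ.vanishing_of_isCompactOperator hx hd hV (isCompactOperator_adjoint_iff.1
      ((hφ.represents_synthesisOp hx h hV).isCompactOp_iff.1 hc)) hlf

theorem criteria_comp (hφ : HasCauchyGram μ φ x) (hx : ∀ i, 0 < x i) (hd : ∀ i, 0 ≤ d i) :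
    MuckenhouptCriteria x (fun n => d n / x n) d
      (compOp (synthesisOp 𝕜 μ φ d) (samplingOp 𝕜 μ φ d)) := by
  have hbdd (h : IsBoundedOp (compOp (synthesisOp 𝕜 μ φ d) (samplingOp 𝕜 μ φ d))) :
      MuckenhouptBounded x (fun n => d n / x n) d := by
    -- An everywhere defined composition forces its inner factor to be everywhere defined, and the
    -- closed graph theorem makes that factor bounded.
    have htop : (samplingOp 𝕜 μ φ d).domain = ⊤ := (Submodule.eq_top_iff').2 fun f =>
      (mem_domain_compOp.1 (by rw [h.1]; trivial :
        f ∈ (compOp (synthesisOp 𝕜 μ φ d) (samplingOp 𝕜 μ φ d)).domain)).1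
    obtain ⟨V, hV⟩ := hφ.exists_represents_of_domain_eq_top htop
    exact (hφ.criteria_samplingOp hx hd).bounded_iff.1 hV.isBoundedOp
  have hrep (h : MuckenhouptBounded x (fun n => d n / x n) d) :
      ∃ V : Lp 𝕜 2 μ →L[𝕜] EllTwo 𝕜, Represents (samplingOp 𝕜 μ φ d) V ∧
        Represents (compOp (synthesisOp 𝕜 μ φ d) (samplingOp 𝕜 μ φ d))
          (ContinuousLinearMap.adjoint V ∘L V) := by
    obtain ⟨V, hV⟩ := hφ.exists_represents_samplingOp (𝕜 := 𝕜) hx hd h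
    exact ⟨V, hV, (hφ.represents_synthesisOp hx h hV).compOp hV⟩
  refine ⟨⟨hbdd, fun h => ?_⟩, fun h hv => ?_, fun hc hlf => ?_⟩
  · obtain ⟨V, -, hS⟩ := hrep h
    exact hS.isBoundedOp
  · obtain ⟨V, hV, hS⟩ := hrep h
    exact hS.isCompactOp_iff.2 (isCompactOperator_adjoint_comp_self_iff.2
      (hφ.isCompactOperator_of_vanishing hx hd hV hv))
  · obtain ⟨V, hV, hS⟩ := hrep (hbdd hc.isBoundedOp)
    exact hφ.vanishing_of_isCompactOperator hx hd hV
      (isCompactOperator_adjoint_comp_self_iff.1 (hS.isCompactOp_iff.1 hc)) hlf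

end HasCauchyGram

theorem exp_neg_sq_le {y s : ℝ} (hy : 0 < y) (hs : 0 < s) :
    Real.exp (-(y * s)) ^ 2 ≤ 1 + 1 / s ^ 2 ∧
      y ^ 2 * Real.exp (-(y * s)) ^ 2 ≤ 1 + 1 / s ^ 2 := by
  have h0 := Real.exp_pos (-(y * s))
  have h1 : Real.exp (-(y * s)) ≤ 1 := Real.exp_le_one_iff.2 (by nlinarith)
  have h2 : y * s * Real.exp (-(y * s)) ≤ 1 := by
    rw [Real.exp_neg, mul_inv_le_iff₀ (Real.exp_pos _), one_mul]
    linarith [Real.add_one_le_exp (y * s)]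
  have h3 : 0 < 1 / s ^ 2 := by positivity
  constructor
  · nlinarith
  · calc y ^ 2 * Real.exp (-(y * s)) ^ 2 = (y * s * Real.exp (-(y * s))) ^ 2 * (1 / s ^ 2) := by
          field_simp
      _ ≤ 1 ^ 2 * (1 / s ^ 2) := by gcongr
      _ ≤ _ := by linarith

theorem hasCauchyGram_exp (hx : ∀ i, 0 < x i) :
    HasCauchyGram (volume.restrict (Set.Ioi (0 : ℝ))) (fun n t => Real.exp (-(x n * t))) x := by
  have hmul (n k : ℕ) : (fun t => Real.exp (-(x n * t)) * Real.exp (-(x k * t))) =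
      fun t => Real.exp (-(x n + x k) * t) := by
    ext t
    rw [← Real.exp_add]
    ring_nf
  have hneg (n k : ℕ) : -(x n + x k) < 0 := by linarith [hx n, hx k]
  refine ⟨fun n => ?_, fun n k => ?_, ?_⟩
  · refine (memLp_two_iff_integrable_sq (by fun_prop)).2 ?_
    simp only [sq]
    rw [hmul]
    exact integrableOn_exp_mul_Ioi (hneg n n) 0
  · rw [hmul, integral_exp_mul_Ioi (hneg n k), mul_zero, Real.exp_zero, neg_div_neg_eq]
  · filter_upwards [ae_restrict_mem measurableSet_Ioi] with t ht
    exact ⟨1 + 1 / t ^ 2, fun n => exp_neg_sq_le (hx n) ht⟩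

/-- The shift by 1/2 makes the exponents add up to x_n + x_k - 1, with integral 1/(x_n + x_k).
Setting s = -log t gives (t^(x_n - 1/2))² = e^(-2 x_n s)/t, reducing the pointwise bound to the
exponential one. -/
theorem hasCauchyGram_rpow (hx : ∀ i, 0 < x i) :
    HasCauchyGram (volume.restrict (Set.Ioo (0 : ℝ) 1)) (fun n t => t ^ (x n - 1 / 2)) x := by
  have hmul (n k : ℕ) : Set.EqOn (fun t : ℝ => t ^ (x n - 1 / 2) * t ^ (x k - 1 / 2))
      (fun t => t ^ (x n + x k - 1)) (Set.Ioo 0 1) := by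
    intro t ht
    simp only
    rw [← Real.rpow_add ht.1]
    ring_nf
  have hgt (n k : ℕ) : -1 < x n + x k - 1 := by linarith [hx n, hx k]
  refine ⟨fun n => ?_, fun n k => ?_, ?_⟩
  · refine (memLp_two_iff_integrable_sq
      (Measurable.aestronglyMeasurable (by fun_prop))).2 ?_
    simp only [sq]
    refine (integrableOn_congr_fun (hmul n n) measurableSet_Ioo).2 ?_
    exact (intervalIntegrable_iff_integrableOn_Ioo_of_le zero_le_one).1
      (intervalIntegral.intervalIntegrable_rpow' (hgt n n))
  · rw [setIntegral_congr_fun measurableSet_Ioo (hmul n k), ← integral_Ioc_eq_integral_Ioo,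
      ← intervalIntegral.integral_of_le zero_le_one, integral_rpow (.inl (hgt n k))]
    have : x n + x k ≠ 0 := by linarith [hx n, hx k, hgt n k]
    simp [this]
  · filter_upwards [ae_restrict_mem measurableSet_Ioo] with t ht
    have hs : 0 < -Real.log t := by linarith [Real.log_neg ht.1 ht.2]
    refine ⟨(1 + 1 / (-Real.log t) ^ 2) / t, fun n => ?_⟩
    have heq : (t ^ (x n - 1 / 2)) ^ 2 = Real.exp (-(x n * -Real.log t)) ^ 2 / t := by
      rw [← Real.rpow_natCast, ← Real.rpow_mul ht.1.le, Real.rpow_def_of_pos ht.1,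
        ← Real.exp_nat_mul]
      nth_rewrite 3 [← Real.exp_log ht.1]
      rw [← Real.exp_sub]
      push_cast
      ring_nf
    obtain ⟨h1, h2⟩ := exp_neg_sq_le (hx n) hs
    rw [heq, ← mul_div_assoc]
    exact ⟨div_le_div_of_nonneg_right h1 ht.1.le, div_le_div_of_nonneg_right h2 ht.1.le⟩

end CauchyCriteria

/-! ### From finite products to N, M and `boundB`. -/

section Conversion

variable {x d : ℕ → ℝ}

theorem tsum_subtype_ofReal_eq_iSup {p : ℕ → Prop} [DecidablePred p] {f : ℕ → ℝ}
    (hf : ∀ k, 0 ≤ f k) :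
    ∑' k : {k // p k}, ENNReal.ofReal (f k) =
      ⨆ F : Finset ℕ, ENNReal.ofReal (∑ k ∈ F with p k, f k) := by
  refine (tsum_subtype {k | p k} fun k => ENNReal.ofReal (f k)).trans ?_
  rw [ENNReal.tsum_eq_iSup_sum]
  refine iSup_congr fun F => ?_
  rw [ENNReal.ofReal_sum_of_nonneg fun k _ => hf k, Finset.sum_filter]
  exact Finset.sum_congr rfl fun k _ => Set.indicator_apply _ _ _

/-- N and M are suprema over finite sets. A product of partial sums over F and G is dominated by the
one over F ∪ G, so the diagonal suffices. -/
theorem sumN_mul_sumM_le_iff {β : ℝ} (hβ : 0 ≤ β) (k : ℕ) :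
    sumN x d (x k) * sumM x d (x k) ≤ ENNReal.ofReal β ↔
      ∀ F, muckenhoupt x (fun n => d n / x n) d F k ≤ β := by
  have hN : sumN x d (x k) = ⨆ F : Finset ℕ, ENNReal.ofReal (∑ j ∈ F with x j ≤ x k, d j ^ 2) :=
    tsum_subtype_ofReal_eq_iSup fun _ => sq_nonneg _
  have hM : sumM x d (x k) =
      ⨆ F : Finset ℕ, ENNReal.ofReal (∑ j ∈ F with x k ≤ x j, (d j / x j) ^ 2) := by
    rw [← tsum_subtype_ofReal_eq_iSup fun _ => sq_nonneg _]
    simp only [div_pow]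
    rfl
  have hmuck (F : Finset ℕ) : ENNReal.ofReal (muckenhoupt x (fun n => d n / x n) d F k) =
      ENNReal.ofReal (∑ j ∈ F with x j ≤ x k, d j ^ 2) *
        ENNReal.ofReal (∑ j ∈ F with x k ≤ x j, (d j / x j) ^ 2) :=
    ENNReal.ofReal_mul (Finset.sum_nonneg fun _ _ => sq_nonneg _)
  rw [hN, hM]
  constructor
  · intro h F
    rw [← ENNReal.ofReal_le_ofReal_iff hβ, hmuck]
    exact le_trans (mul_le_mul' (le_iSup (fun F : Finset ℕ =>
      ENNReal.ofReal (∑ j ∈ F with x j ≤ x k, d j ^ 2)) F) (le_iSup (fun F : Finset ℕ =>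
      ENNReal.ofReal (∑ j ∈ F with x k ≤ x j, (d j / x j) ^ 2)) F)) h
  · intro h
    simp only [ENNReal.iSup_mul, ENNReal.mul_iSup]
    refine iSup_le fun F => iSup_le fun G => ?_
    refine le_trans (mul_le_mul' ?_ ?_)
      ((hmuck (F ∪ G)).symm.trans_le (ENNReal.ofReal_le_ofReal (h (F ∪ G))))
    all_goals
      refine ENNReal.ofReal_le_ofReal (Finset.sum_le_sum_of_subset_of_nonneg
        (Finset.filter_subset_filter _ ?_) fun _ _ _ => sq_nonneg _)
      simp

theorem iSup_sumN_mul_sumM_lt_top_iff :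
    ⨆ k, sumN x d (x k) * sumM x d (x k) < ∞ ↔
      MuckenhouptBounded x (fun n => d n / x n) d := by
  constructor
  · intro h
    refine ⟨(⨆ k, sumN x d (x k) * sumM x d (x k)).toReal, fun F k => ?_⟩
    refine (sumN_mul_sumM_le_iff ENNReal.toReal_nonneg k).1 ?_ F
    rw [ENNReal.ofReal_toReal h.ne]
    exact le_iSup (fun k => sumN x d (x k) * sumM x d (x k)) k
  · rintro ⟨β, hβ⟩
    have hβ0 : 0 ≤ β := (muckenhoupt_nonneg x _ d ∅ 0).trans (hβ ∅ 0)
    exact (iSup_le fun k => (sumN_mul_sumM_le_iff hβ0 k).2 fun F => hβ F k).trans_lt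
      ENNReal.ofReal_lt_top

theorem tendsto_iSup_sumN_mul_sumM_iff :
    Tendsto (fun L => ⨆ k ≥ L, sumN x d (x k) * sumM x d (x k)) atTop (𝓝 0) ↔
      MuckenhouptVanishing x (fun n => d n / x n) d := by
  rw [ENNReal.tendsto_atTop_zero]
  constructor
  · intro h ε hε
    obtain ⟨L, hL⟩ := h (ENNReal.ofReal ε) (ENNReal.ofReal_pos.2 hε)
    filter_upwards [eventually_ge_atTop L] with k hk
    exact (sumN_mul_sumM_le_iff hε.le k).1 ((le_iSup₂ (f := fun k (_ : k ≥ L) =>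
      sumN x d (x k) * sumM x d (x k)) k hk).trans (hL L le_rfl))
  · intro h ε hε
    rcases eq_or_ne ε ∞ with rfl | hε'
    · exact ⟨0, fun _ _ => le_top⟩
    obtain ⟨L, hL⟩ := eventually_atTop.1 (h ε.toReal (ENNReal.toReal_pos hε.ne' hε'))
    refine ⟨L, fun m hm => iSup₂_le fun k hk => ?_⟩
    rw [← ENNReal.ofReal_toReal hε']
    exact (sumN_mul_sumM_le_iff ENNReal.toReal_nonneg k).2 (hL k (hm.trans hk))

/-- The lower (or upper) sets are images under σ of initial segments of ℕ. -/
theorem MonotonicallyRearrangeable.locallyFinite (h : MonotonicallyRearrangeable x) :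
    LocallyFiniteBelowOrAbove x := by
  obtain ⟨σ, h | h⟩ := h
  · refine .inl fun n => ((Set.finite_Iic (σ.symm n)).image σ).subset fun k hk => ?_
    refine ⟨σ.symm k, h.le_iff_le.1 ?_, by simp⟩
    simpa using hk
  · refine .inr fun n => ((Set.finite_Iic (σ.symm n)).image σ).subset fun k hk => ?_
    refine ⟨σ.symm k, h.le_iff_ge.1 ?_, by simp⟩
    simpa using hk

theorem MuckenhouptCriteria.satisfiesCriteria {𝕜 : Type*} [RCLike 𝕜] {E F : Type*}
    [NormedAddCommGroup E] [NormedSpace 𝕜 E] [NormedAddCommGroup F] [NormedSpace 𝕜 F]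
    {T : E →ₗ.[𝕜] F} (h : MuckenhouptCriteria x (fun n => d n / x n) d T) :
    SatisfiesCriteria x d T := by
  refine ⟨fun hB => ?_, fun hT hB => ?_, fun hmono => ⟨?_, fun hc => ⟨hc.isBoundedOp, ?_⟩, ?_⟩⟩
  · refine h.bounded_iff.2 (iSup_sumN_mul_sumM_lt_top_iff.1 (lt_of_le_of_lt ?_ hB))
    -- Only the second summand of `boundB` is kept.
    refine le_trans (iSup_le fun k => ?_) le_add_self
    exact le_iSup₂ (f := fun k (_ : k ≥ 0) => sumN x d (x k) * sumM x d (x k)) k (Nat.zero_le k)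
  · refine h.isCompactOp (h.bounded_iff.1 hT) (tendsto_iSup_sumN_mul_sumM_iff.1 ?_)
    exact tendsto_of_tendsto_of_tendsto_of_le_of_le tendsto_const_nhds hB (fun _ => zero_le)
      fun _ => le_add_self
  · exact h.bounded_iff.trans iSup_sumN_mul_sumM_lt_top_iff.symm
  · exact tendsto_iSup_sumN_mul_sumM_iff.2 (h.vanishing hc hmono.locallyFinite)
  · rintro ⟨hT, hv⟩
    exact h.isCompactOp (h.bounded_iff.1 hT) (tendsto_iSup_sumN_mul_sumM_iff.1 hv)

theorem cesaroOp_eq_hardyOp (𝕜 : Type*) [RCLike 𝕜] (x d : ℕ → ℝ) :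
    cesaroOp 𝕜 x d = hardyOp 𝕜 x (fun n => d n / x n) d :=
  rfl

theorem cesaroAdj_eq_hardyOp (𝕜 : Type*) [RCLike 𝕜] (x d : ℕ → ℝ) :
    cesaroAdj 𝕜 x d = hardyOp 𝕜 (fun i => -x i) d fun n => d n / x n := by
  have h : (fun n k => x n ≤ x k) = fun n k => -x k ≤ -x n := by
    ext n k
    exact neg_le_neg_iff.symm
  rw [cesaroAdj, hardyOp, h]

end Conversion

end

theorem theorem2 {𝕜 : Type*} [RCLike 𝕜] (x d : ℕ → ℝ) (hx : ∀ i, 0 < x i)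
    (hinj : Function.Injective x) (hd : ∀ i, 0 ≤ d i) :
    (SatisfiesCriteria x d (hausdorffOp 𝕜 (fun n => x n - 1 / 2) d) ∧
      SatisfiesCriteria x d (hausdorffAdj 𝕜 (fun n => x n - 1 / 2) d) ∧
      SatisfiesCriteria x d (compOp (hausdorffAdj 𝕜 (fun n => x n - 1 / 2) d)
        (hausdorffOp 𝕜 (fun n => x n - 1 / 2) d))) ∧
    (SatisfiesCriteria x d (laplaceOp 𝕜 x d) ∧
      SatisfiesCriteria x d (laplaceAdj 𝕜 x d) ∧
      SatisfiesCriteria x d (compOp (laplaceAdj 𝕜 x d) (laplaceOp 𝕜 x d))) ∧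
    (SatisfiesCriteria x d (cesaroOp 𝕜 x d) ∧
      SatisfiesCriteria x d (cesaroAdj 𝕜 x d) ∧
      SatisfiesCriteria x d (compOp (cesaroOp 𝕜 x d) (cesaroAdj 𝕜 x d)) ∧
      SatisfiesCriteria x d (compOp (cesaroAdj 𝕜 x d) (cesaroOp 𝕜 x d))) := by
  have hr := hasCauchyGram_rpow hx
  have he := hasCauchyGram_exp hx
  have ha (i) : 0 ≤ d i / x i := div_nonneg (hd i) (hx i).le
  have ht := hasFiniteTails (d := d) hx
  -- For CC* the inner factor is the adjoint, so the composition result is used for -x, where -(-x)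
  -- must be simplified back to x.
  have hcomp := (muckenhouptCriteria_hardyOp_comp (𝕜 := 𝕜) hd ha ht.neg).neg
  simp only [neg_neg] at hcomp
  refine ⟨⟨(hr.criteria_samplingOp hx hd).satisfiesCriteria,
    (hr.criteria_synthesisOp hx hd).satisfiesCriteria,
    (hr.criteria_comp hx hd).satisfiesCriteria⟩,
    ⟨(he.criteria_samplingOp hx hd).satisfiesCriteria,
    (he.criteria_synthesisOp hx hd).satisfiesCriteria,
    (he.criteria_comp hx hd).satisfiesCriteria⟩, ?_⟩
  rw [cesaroAdj_eq_hardyOp, cesaroOp_eq_hardyOp]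
  exact ⟨(muckenhouptCriteria_hardyOp ha hd ht).satisfiesCriteria,
    (muckenhouptCriteria_hardyOp hd ha ht.neg).neg.satisfiesCriteria,
    hcomp.satisfiesCriteria, (muckenhouptCriteria_hardyOp_comp ha hd ht).satisfiesCriteria⟩
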